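/- Let $\mathcal D$ be an abelian braided monoidal category (with biadditive tensor product), with braiding $c$, that has countable coproducts which are preserved by the tensor product in each variable. Associators and unit isomorphisms are suppressed below. **Tensor algebras.** For $F\in\mathcal D$ let $T(F)=\bigoplus_{n\ge 0}F^{\otimes n}$ be the tensor algebra with $\iota_F:F\to T(F)$. It is a Hopf algebra in $\mathcal D$ with coproduct and counit the algebra morphisms determined by $\Delta\circ\iota_F=\iota_F\otimes\eta+\eta\otimes\iota_F$ and $\varepsilon\circ\iota_F=0$, where $A\otimes B$ carries the product $(\mu_A\otimes\mu_B)\circ(\mathrm{id}\otimes c_{B,A}\otimes\mathrm{id})$. **Hopf pairings.** A Hopf pairing of $H_1,H_2$ is a morphism $\rho:H_1\otimes H_2\to\mathbf 1$ with $\rho(\mu\otimes\mathrm{id})=\rho(\mathrm{id}\otimes\rho\otimes\mathrm{id})(\mathrm{id}\otimes\mathrm{id}\otimes\Delta)$, $\rho(\eta\otimes\mathrm{id})=\varepsilon$, $\rho(\mathrm{id}\otimes\mu)=\rho(\mathrm{id}\otimes\rho\otimes\mathrm{id})(\Delta\otimes\mathrm{id}\otimes\mathrm{id})$, $\rho(\mathrm{id}\otimes\eta)=\varepsilon$.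 For $F^+,F^-\in\mathcal D$ and $b:F^+\otimes F^-\to\mathbf 1$ let $\rho(b):T(F^+)\otimes T(F^-)\to\mathbf 1$ be the unique Hopf pairing with $\rho(b)\circ(\iota_{F^+}\otimes\iota_{F^-})=b$. **Yetter–Drinfeld modules.** Let $\rho$ be a Hopf pairing of $H_1,H_2$, let $m_1:H_1\otimes X\to X$ be a left action and $m_2:X\otimes H_2\to X$ a right action. Then $(X,m_1,m_2)$ is a Yetter–Drinfeld module for $H_1,H_2,\rho$ if, as morphisms $H_1\otimes X\otimes H_2\to X$, $$m_1\circ(\mathrm{id}\otimes\mathrm{id}_X\otimes\rho)\circ(\mathrm{id}\otimes c_{H_1,X}\otimes\mathrm{id})\circ(\mathrm{id}\otimes\mathrm{id}\otimes m_2\otimes\mathrm{id})\circ(\Delta\otimes\mathrm{id}_X\otimes\Delta)$$ $$=\;m_2\circ(\rho\otimes\mathrm{id}_X\otimes\mathrm{id})\circ(\mathrm{id}\otimes c_{X,H_2}\otimes\mathrm{id})\circ(\mathrm{id}\otimes m_1\otimes\mathrm{id}\otimes\mathrm{id})\circ(\Delta\otimes\mathrm{id}_X\otimes\Delta).$$ **Commutation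 condition.** For an object $F$ of the monoidal centre $\mathcal Z(\mathcal D)$ (with half-braiding $\varphi_{F,U}:F\otimes U\to U\otimes F$), an object of the category $\mathcal D_F$ is a pair $(X,m)$ with $X\in\mathcal D$ and $m:F\otimes X\to X$ a morphism in $\mathcal D$. Let $A,B\in\mathcal Z(\mathcal D)$ and let $b:A\otimes B\to\mathbf 1$ be a morphism in $\mathcal D$. Then $(X,m)\in\mathcal D_{A\oplus B}$, with restrictions $m_A,m_B$ of $m$ to $A\otimes X$ and $B\otimes X$, satisfies the commutation condition with $b$ if, as morphisms $A\otimes B\otimes X\to X$, $$m_A\circ(\mathrm{id}_A\otimes m_B)-m_B\circ(\mathrm{id}_B\otimes m_A)\circ(\varphi_{A,B}\otimes\mathrm{id}_X)=b\otimes\mathrm{id}_X-(\mathrm{id}_X\otimes b)\circ\varphi_{A\otimes B,X}.$$ **Proposition.** Let $F^+,F^-,X\in\mathcal D$ and $b:F^+\otimes F^-\to\mathbf 1$. Put $F=\iota^+(F^+)\oplus\iota^-(F^-)\in\mathcal Z(\mathcal D)$, where $\iota^+(U)=(U,c_{U,-})$ and $\iota^-(U)=(U,c_{-,U}^{-1})$.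 Let $m_+$ be a left action of $T(F^+)$ on $X$ and $m_-$ a right action of $T(F^-)$ on $X$. Then the following are equivalent: (a) $(X,m_+,m_-)$ is a Yetter–Drinfeld module for $T(F^+),T(F^-),\rho(b)$; (b) the object $(X,m)\in\mathcal D_F$, where $m$ is $m_+\circ(\iota_{F^+}\otimes\mathrm{id}_X)$ on $F^+\otimes X$ and $m_-\circ(\mathrm{id}_X\otimes\iota_{F^-})\circ c_{X,F^-}^{-1}$ on $F^-\otimes X$, satisfies the commutation condition with $b$. -/

import Mathlib

open CategoryTheory Category Limits MonoidalCategory BraidedCategory MonObj ComonObj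

universe v u
set_option linter.unusedSectionVars false

noncomputable section

namespace TensorHopf

section Nest

variable {D : Type u} [Category.{v} D] [MonoidalCategory D]

/-- The nested evaluation `A ⊗ A' ⊗ B ⊗ B' → 𝟙` pairing the inner factors `A' ⊗ B` by `q` and then
the outer factors `A ⊗ B'` by `p`. -/
def nest {A A' B B' : D} (p : A ⊗ B' ⟶ 𝟙_ D) (q : A' ⊗ B ⟶ 𝟙_ D) :
    (A ⊗ A') ⊗ (B ⊗ B') ⟶ 𝟙_ D :=
  (α_ A A' (B ⊗ B')).hom ≫ A ◁ ((α_ A' B B').inv ≫ q ▷ B' ≫ (λ_ B').hom) ≫ p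

lemma nest_left {A A' B B' C C' : D} (p : A ⊗ B' ⟶ 𝟙_ D) (q : A' ⊗ B ⟶ 𝟙_ D)
    (f : C ⟶ A) (g : C' ⟶ A') :
    (f ⊗ₘ g) ▷ (B ⊗ B') ≫ nest p q = nest (f ▷ B' ≫ p) (g ▷ B ≫ q) := by
  simp only [nest, MonoidalCategory.tensorHom_def, comp_whiskerRight, MonoidalCategory.whiskerLeft_comp, assoc]
  rw [whisker_exchange_assoc, whisker_exchange_assoc, whisker_exchange_assoc]
  simp

lemma nest_right {A A' B B' C C' : D} (p : A ⊗ B' ⟶ 𝟙_ D) (q : A' ⊗ B ⟶ 𝟙_ D)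
    (f : C ⟶ B) (g : C' ⟶ B') :
    (A ⊗ A') ◁ (f ⊗ₘ g) ≫ nest p q = nest (A ◁ g ≫ p) (A' ◁ f ≫ q) := by
  simp only [nest, MonoidalCategory.tensorHom_def, comp_whiskerRight, MonoidalCategory.whiskerLeft_comp, assoc]
  have : A ◁ A' ◁ B ◁ g ≫ A ◁ (α_ A' B B').inv ≫ A ◁ q ▷ B' ≫ A ◁ (λ_ B').hom =
     A ◁ (α_ A' B C').inv ≫ A ◁ q ▷ C' ≫ A ◁ (λ_ C').hom ≫ A ◁ g := by
    simp only [← MonoidalCategory.whiskerLeft_comp]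
    rw [associator_inv_naturality_right_assoc, whisker_exchange_assoc, leftUnitor_naturality]
  simp [← reassoc_of% this]

lemma nest_braid [BraidedCategory D] {A A' B B' : D} (p : A ⊗ B' ⟶ 𝟙_ D) (q : A' ⊗ B ⟶ 𝟙_ D) :
    (A ⊗ A') ◁ (β_ B' B).hom ≫ nest p q = (β_ A A').hom ▷ (B' ⊗ B) ≫ nest q p := by
  have h1 : p ▷ B ≫ (λ_ B).hom = (α_ A B' B).hom ≫ A ◁ (β_ B' B).hom ≫ (α_ A B B').inv ≫
      (β_ A B).hom ▷ B' ≫ (α_ B A B').hom ≫ B ◁ p ≫ (ρ_ B).hom := by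
    have := braiding_naturality_left p B
    rw [braiding_tensorUnit_left, braiding_tensor_left_hom, ← assoc, ← assoc,
      Iso.comp_inv_eq] at this
    rw [this]; simp
  have h2 : (β_ A A').hom ▷ B ≫ (α_ A' A B).hom ≫ A' ◁ (β_ A B).hom ≫ (α_ A' B A).inv ≫ q ▷ A =
      (α_ A A' B).hom ≫ A ◁ q ≫ (ρ_ A).hom ≫ (λ_ A).inv := by
    have := braiding_naturality_right A q
    rw [braiding_tensorUnit_right, braiding_tensor_right_hom] at this
    rw [this]; simp
  symm
  calc
    _ = 𝟙 _ ⊗≫ (β_ A A').hom ▷ (B' ⊗ B) ⊗≫ A' ◁ (p ▷ B ≫ (λ_ B).hom) ≫ q := by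
      simp only [nest]; monoidal
    _ = 𝟙 _ ⊗≫ ((β_ A A').hom ▷ (B' ⊗ B) ≫ (A' ⊗ A) ◁ (β_ B' B).hom) ⊗≫
        A' ◁ (β_ A B).hom ▷ B' ⊗≫ ((A' ⊗ B) ◁ p ≫ q ▷ 𝟙_ D) ⊗≫ 𝟙 _ := by
      rw [h1]; monoidal
    _ = 𝟙 _ ⊗≫ (A ⊗ A') ◁ (β_ B' B).hom ⊗≫
        ((β_ A A').hom ▷ B ≫ (α_ A' A B).hom ≫ A' ◁ (β_ A B).hom ≫ (α_ A' B A).inv ≫ q ▷ A) ▷ B'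
          ⊗≫ p := by
      rw [← whisker_exchange, whisker_exchange q p]; monoidal
    _ = _ := by
      rw [h2]; simp only [nest]; monoidal

lemma nest_nest [BraidedCategory D] {X₁ X₂ Y₁ Y₂ Z₁ Z₂ W₁ W₂ : D} (x : X₁ ⊗ W₂ ⟶ 𝟙_ D)
    (x' : X₂ ⊗ Z₂ ⟶ 𝟙_ D) (y : Y₁ ⊗ W₁ ⟶ 𝟙_ D) (y' : Y₂ ⊗ Z₁ ⟶ 𝟙_ D) :
    ((X₁ ⊗ X₂) ⊗ (Y₁ ⊗ Y₂)) ◁ tensorμ Z₁ Z₂ W₁ W₂ ≫ nest (nest x x') (nest y y') =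
      tensorμ X₁ X₂ Y₁ Y₂ ▷ ((Z₁ ⊗ Z₂) ⊗ (W₁ ⊗ W₂)) ≫ nest (nest x y) (nest x' y') := by
  have h := nest_braid x' y
  calc
    _ = 𝟙 (((X₁ ⊗ X₂) ⊗ Y₁ ⊗ Y₂) ⊗ (Z₁ ⊗ Z₂) ⊗ W₁ ⊗ W₂) ⊗≫ X₁ ◁ X₂ ◁ Y₁ ◁ (y' ▷ (Z₂ ⊗ W₁ ⊗ W₂)) ⊗≫ X₁ ◁ ((X₂ ⊗ Y₁) ◁ (β_ Z₂ W₁).hom ≫ nest x' y) ▷ W₂ ⊗≫ x := by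
      have e : 𝟙 (((X₁ ⊗ X₂) ⊗ Y₁ ⊗ Y₂) ⊗ (Z₁ ⊗ Z₂) ⊗ W₁ ⊗ W₂) ⊗≫ X₁ ◁ X₂ ◁ Y₁ ◁ (((Y₂ ⊗ Z₁) ◁ ((β_ Z₂ W₁).hom ▷ W₂)) ≫ y' ▷ ((W₁ ⊗ Z₂) ⊗ W₂))
            ⊗≫ X₁ ◁ (nest x' y) ▷ W₂ ⊗≫ x =
          𝟙 (((X₁ ⊗ X₂) ⊗ Y₁ ⊗ Y₂) ⊗ (Z₁ ⊗ Z₂) ⊗ W₁ ⊗ W₂) ⊗≫ X₁ ◁ X₂ ◁ Y₁ ◁ (y' ▷ (Z₂ ⊗ W₁ ⊗ W₂)) ⊗≫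
            X₁ ◁ ((X₂ ⊗ Y₁) ◁ (β_ Z₂ W₁).hom ≫ nest x' y) ▷ W₂ ⊗≫ x := by
        rw [whisker_exchange]; monoidal
      rw [← e]
      simp only [nest, tensorμ]
      monoidal
    _ = 𝟙 (((X₁ ⊗ X₂) ⊗ Y₁ ⊗ Y₂) ⊗ (Z₁ ⊗ Z₂) ⊗ W₁ ⊗ W₂) ⊗≫ X₁ ◁ X₂ ◁ Y₁ ◁ (y' ▷ (Z₂ ⊗ W₁ ⊗ W₂)) ⊗≫ X₁ ◁ ((β_ X₂ Y₁).hom ▷ (Z₂ ⊗ W₁) ≫ nest y x') ▷ W₂ ⊗≫ x := by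
      rw [h]
    _ = _ := by
      have e : 𝟙 (((X₁ ⊗ X₂) ⊗ Y₁ ⊗ Y₂) ⊗ (Z₁ ⊗ Z₂) ⊗ W₁ ⊗ W₂) ⊗≫ X₁ ◁ (((X₂ ⊗ Y₁) ◁ (y' ▷ (Z₂ ⊗ W₁))) ≫ (β_ X₂ Y₁).hom ▷ (𝟙_ D ⊗ Z₂ ⊗ W₁)) ▷ W₂
            ⊗≫ X₁ ◁ (nest y x') ▷ W₂ ⊗≫ x =
          𝟙 (((X₁ ⊗ X₂) ⊗ Y₁ ⊗ Y₂) ⊗ (Z₁ ⊗ Z₂) ⊗ W₁ ⊗ W₂) ⊗≫ X₁ ◁ X₂ ◁ Y₁ ◁ (y' ▷ (Z₂ ⊗ W₁ ⊗ W₂)) ⊗≫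
            X₁ ◁ ((β_ X₂ Y₁).hom ▷ (Z₂ ⊗ W₁) ≫ nest y x') ▷ W₂ ⊗≫ x := by
        monoidal
      rw [← e, whisker_exchange]
      simp only [nest, tensorμ]
      monoidal


lemma nest_assoc {A B C S₁ S₂ S₃ : D} (x : A ⊗ S₃ ⟶ 𝟙_ D) (y : B ⊗ S₂ ⟶ 𝟙_ D) (z : C ⊗ S₁ ⟶ 𝟙_ D) :
    nest (nest x y) z = ((α_ A B C).hom ⊗ₘ (α_ S₁ S₂ S₃).inv) ≫ nest x (nest y z) := by
  simp only [nest]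
  monoidal

section conv
variable {S : D} [ComonObj S]

/-- The product `x * y : (A ⊗ B) ⊗ S → 𝟙` obtained from the coproduct of `S` and nesting. -/
def conv {A B : D} (x : A ⊗ S ⟶ 𝟙_ D) (y : B ⊗ S ⟶ 𝟙_ D) : (A ⊗ B) ⊗ S ⟶ 𝟙_ D :=
  (A ⊗ B) ◁ Δ[S] ≫ nest x y

lemma conv_nat {A B A' B' : D} (x : A ⊗ S ⟶ 𝟙_ D) (y : B ⊗ S ⟶ 𝟙_ D) (f : A' ⟶ A) (g : B' ⟶ B) :
    (f ⊗ₘ g) ▷ S ≫ conv x y = conv (f ▷ S ≫ x) (g ▷ S ≫ y) := by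
  rw [conv, conv, ← whisker_exchange_assoc, nest_left]

lemma conv_assoc {A B C : D} (x : A ⊗ S ⟶ 𝟙_ D) (y : B ⊗ S ⟶ 𝟙_ D) (z : C ⊗ S ⟶ 𝟙_ D) :
    conv (conv x y) z = (α_ A B C).hom ▷ S ≫ conv x (conv y z) := by
  have h1 : nest (conv x y) z = ((A ⊗ B) ⊗ C) ◁ (S ◁ Δ[S]) ≫ nest (nest x y) z := by
    have := nest_right (nest x y) z (𝟙 S) Δ[S]
    simp only [id_tensorHom] at this
    rw [this, conv]; simp
  have h2 : nest x (conv y z) = (A ⊗ (B ⊗ C)) ◁ (Δ[S] ▷ S) ≫ nest x (nest y z) := by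
    have := nest_right x (nest y z) Δ[S] (𝟙 S)
    simp only [tensorHom_id] at this
    rw [this, conv]; simp
  have h3 : Δ[S] ≫ S ◁ Δ[S] ≫ (α_ S S S).inv = Δ[S] ≫ Δ[S] ▷ S := by simp
  rw [conv, h1, conv, h2, nest_assoc, MonoidalCategory.tensorHom_def', assoc,
    ← MonoidalCategory.whiskerLeft_comp_assoc, ← MonoidalCategory.whiskerLeft_comp_assoc, assoc, h3,
    ← whisker_exchange_assoc, ← whisker_exchange_assoc, MonoidalCategory.whiskerLeft_comp_assoc]

lemma conv_counit_left {A : D} (x : A ⊗ S ⟶ 𝟙_ D) :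
    conv ((λ_ _).hom ≫ ε[S]) x = (λ_ A).hom ▷ S ≫ x := by
  have h := nest_right (λ_ (𝟙_ D)).hom x (𝟙 S) ε[S]
  rw [id_tensorHom, leftUnitor_naturality, whiskerLeft_id_assoc] at h
  rw [conv, ← h, ← MonoidalCategory.whiskerLeft_comp_assoc, comul_counit, nest]
  monoidal

lemma conv_counit_right {A : D} (x : A ⊗ S ⟶ 𝟙_ D) :
    conv x ((λ_ _).hom ≫ ε[S]) = (ρ_ A).hom ▷ S ≫ x := by
  have h := nest_right x (λ_ (𝟙_ D)).hom ε[S] (𝟙 S)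
  rw [tensorHom_id, leftUnitor_naturality, whiskerLeft_id_assoc] at h
  rw [conv, ← h, ← MonoidalCategory.whiskerLeft_comp_assoc, counit_comul, nest]
  monoidal

end conv

end Nest


section TensorAlgebra

variable {D : Type u} [Category.{v} D] [MonoidalCategory D]

/-- The `n`-th tensor power, `F^{⊗ 0} = 𝟙` and `F^{⊗ (n + 1)} = F^{⊗ n} ⊗ F`. -/
def tpow (F : D) : ℕ → D
  | 0 => 𝟙_ D
  | n + 1 => tpow F n ⊗ F

variable [HasCoproductsOfShape ℕ D]

/-- The object `⨁ₙ F^{⊗ n}` underlying the tensor algebra `T(F)`. -/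
def TensorAlg (F : D) : D := ∐ tpow F

namespace TensorAlg

variable (F : D)

/-- The embedding of the `n`-th tensor power. -/
def incl (n : ℕ) : tpow F n ⟶ TensorAlg F := Sigma.ι (tpow F) n

/-- The unit of the tensor algebra. -/
def unit : 𝟙_ D ⟶ TensorAlg F := incl F 0

variable {F}

/-- The morphism out of `T(F)` with given components. -/
def desc {Z : D} (f : ∀ n, tpow F n ⟶ Z) : TensorAlg F ⟶ Z := Sigma.desc f

@[simp]
lemma incl_desc {Z : D} (f : ∀ n, tpow F n ⟶ Z) (n : ℕ) : incl F n ≫ desc f = f n :=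
  Sigma.ι_desc f n

lemma hom_ext {Z : D} {f g : TensorAlg F ⟶ Z} (h : ∀ n, incl F n ≫ f = incl F n ≫ g) : f = g :=
  Sigma.hom_ext _ _ h

variable [∀ Y : D, PreservesColimitsOfShape (Discrete ℕ) (tensorLeft Y)]
  [∀ Y : D, PreservesColimitsOfShape (Discrete ℕ) (tensorRight Y)]

/-- The morphism out of `T(F) ⊗ Y` with given components. -/
def descR (Y : D) {Z : D} (f : ∀ n, tpow F n ⊗ Y ⟶ Z) : TensorAlg F ⊗ Y ⟶ Z :=
  Cofan.IsColimit.desc (isColimitCofanMkObjOfIsColimit (tensorRight Y) (tpow F)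
    (fun n => Sigma.ι (tpow F) n) (coproductIsCoproduct (tpow F))) f

@[simp]
lemma incl_descR (Y : D) {Z : D} (f : ∀ n, tpow F n ⊗ Y ⟶ Z) (n : ℕ) :
    incl F n ▷ Y ≫ descR Y f = f n :=
  Cofan.IsColimit.fac (isColimitCofanMkObjOfIsColimit (tensorRight Y) (tpow F)
    (fun n => Sigma.ι (tpow F) n) (coproductIsCoproduct (tpow F))) f n

lemma hom_ext_right {Y Z : D} {f g : TensorAlg F ⊗ Y ⟶ Z}
    (h : ∀ n, incl F n ▷ Y ≫ f = incl F n ▷ Y ≫ g) : f = g :=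
  Cofan.IsColimit.hom_ext (isColimitCofanMkObjOfIsColimit (tensorRight Y) (tpow F)
    (fun n => Sigma.ι (tpow F) n) (coproductIsCoproduct (tpow F))) _ _ h

/-- The morphism out of `Y ⊗ T(F)` with given components. -/
def descL (Y : D) {Z : D} (f : ∀ n, Y ⊗ tpow F n ⟶ Z) : Y ⊗ TensorAlg F ⟶ Z :=
  Cofan.IsColimit.desc (isColimitCofanMkObjOfIsColimit (tensorLeft Y) (tpow F)
    (fun n => Sigma.ι (tpow F) n) (coproductIsCoproduct (tpow F))) f

@[simp]
lemma incl_descL (Y : D) {Z : D} (f : ∀ n, Y ⊗ tpow F n ⟶ Z) (n : ℕ) :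
    Y ◁ incl F n ≫ descL Y f = f n :=
  Cofan.IsColimit.fac (isColimitCofanMkObjOfIsColimit (tensorLeft Y) (tpow F)
    (fun n => Sigma.ι (tpow F) n) (coproductIsCoproduct (tpow F))) f n

lemma hom_ext_left {Y Z : D} {f g : Y ⊗ TensorAlg F ⟶ Z}
    (h : ∀ n, Y ◁ incl F n ≫ f = Y ◁ incl F n ≫ g) : f = g :=
  Cofan.IsColimit.hom_ext (isColimitCofanMkObjOfIsColimit (tensorLeft Y) (tpow F)
    (fun n => Sigma.ι (tpow F) n) (coproductIsCoproduct (tpow F))) _ _ h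

lemma hom_ext_mid {Y Y' Z : D} {f g : Y ⊗ TensorAlg F ⊗ Y' ⟶ Z}
    (h : ∀ n, Y ◁ incl F n ▷ Y' ≫ f = Y ◁ incl F n ▷ Y' ≫ g) : f = g :=
  Cofan.IsColimit.hom_ext (isColimitCofanMkObjOfIsColimit (tensorRight Y' ⋙ tensorLeft Y) (tpow F)
    (fun n => Sigma.ι (tpow F) n) (coproductIsCoproduct (tpow F))) _ _ h

variable (F)

/-- The canonical map `F^{⊗ n} ⊗ F^{⊗ m} → F^{⊗ (n + m)}`, a composite of associators. -/
def concat (n : ℕ) : ∀ m : ℕ, tpow F n ⊗ tpow F m ⟶ tpow F (n + m)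
  | 0 => (ρ_ (tpow F n)).hom
  | m + 1 => (α_ (tpow F n) (tpow F m) F).inv ≫ concat n m ▷ F

/-- The multiplication of the tensor algebra, given by concatenation. -/
def mul : TensorAlg F ⊗ TensorAlg F ⟶ TensorAlg F :=
  descR _ fun n => descL _ fun m => concat F n m ≫ incl F (n + m)

lemma incl_incl_mul (n m : ℕ) :
    (incl F n ⊗ₘ incl F m) ≫ mul F = concat F n m ≫ incl F (n + m) := by
  simp [mul, tensorHom_def']

/-- Right multiplication by the generating object. -/
def succ : TensorAlg F ⊗ F ⟶ TensorAlg F := descR _ fun n => incl F (n + 1)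


lemma incl_succ (n : ℕ) :
    (incl F n ▷ F ≫ succ F : tpow F n ⊗ F ⟶ TensorAlg F) = incl F (n + 1) :=
  incl_descR F (fun n => incl F (n + 1)) n

variable {F}

lemma incl_induction {P : ∀ ⦃A : D⦄, (A ⟶ TensorAlg F) → Prop} (h0 : P (unit F))
    (hs : ∀ n, P (incl F n) → P (incl F n ▷ F ≫ succ F)) (n : ℕ) : P (incl F n) := by
  induction n with
  | zero => exact h0
  | succ n ih => have := hs n ih; rw [incl_succ] at this; exact this

lemma ext_ind {Z : D} {f g : TensorAlg F ⟶ Z} (h0 : unit F ≫ f = unit F ≫ g)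
    (hs : ∀ n, incl F n ≫ f = incl F n ≫ g →
      (incl F n ▷ F ≫ succ F) ≫ f = (incl F n ▷ F ≫ succ F) ≫ g) : f = g :=
  hom_ext fun n => incl_induction (P := fun _ p => p ≫ f = p ≫ g) h0 hs n

lemma ext_ind_left {Y Z : D} {f g : Y ⊗ TensorAlg F ⟶ Z} (h0 : Y ◁ unit F ≫ f = Y ◁ unit F ≫ g)
    (hs : ∀ n, Y ◁ incl F n ≫ f = Y ◁ incl F n ≫ g →
      Y ◁ (incl F n ▷ F ≫ succ F) ≫ f = Y ◁ (incl F n ▷ F ≫ succ F) ≫ g) : f = g :=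
  hom_ext_left fun n => incl_induction (P := fun _ p => Y ◁ p ≫ f = Y ◁ p ≫ g) h0 hs n

lemma ext_ind_right {Y Z : D} {f g : TensorAlg F ⊗ Y ⟶ Z} (h0 : unit F ▷ Y ≫ f = unit F ▷ Y ≫ g)
    (hs : ∀ n, incl F n ▷ Y ≫ f = incl F n ▷ Y ≫ g →
      (incl F n ▷ F ≫ succ F) ▷ Y ≫ f = (incl F n ▷ F ≫ succ F) ▷ Y ≫ g) : f = g :=
  hom_ext_right fun n => incl_induction (P := fun _ p => p ▷ Y ≫ f = p ▷ Y ≫ g) h0 hs n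

lemma ext_ind_mid {Y Y' Z : D} {f g : Y ⊗ TensorAlg F ⊗ Y' ⟶ Z}
    (h0 : Y ◁ unit F ▷ Y' ≫ f = Y ◁ unit F ▷ Y' ≫ g)
    (hs : ∀ n, Y ◁ incl F n ▷ Y' ≫ f = Y ◁ incl F n ▷ Y' ≫ g →
      Y ◁ (incl F n ▷ F ≫ succ F) ▷ Y' ≫ f = Y ◁ (incl F n ▷ F ≫ succ F) ▷ Y' ≫ g) : f = g :=
  hom_ext_mid fun n => incl_induction (P := fun _ p => Y ◁ p ▷ Y' ≫ f = Y ◁ p ▷ Y' ≫ g) h0 hs n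

variable (F)

lemma mul_unit : TensorAlg F ◁ unit F ≫ mul F = (ρ_ (TensorAlg F)).hom := by
  apply hom_ext_right; intro n
  have : (incl F n ⊗ₘ unit F) ≫ mul F = (ρ_ _).hom ≫ incl F n := incl_incl_mul F n 0
  rw [MonoidalCategory.tensorHom_def, assoc] at this
  rw [this]
  exact (rightUnitor_naturality (incl F n)).symm

lemma mul_unit_assoc {Z : D} (h : TensorAlg F ⟶ Z) :
    TensorAlg F ◁ unit F ≫ mul F ≫ h = (ρ_ (TensorAlg F)).hom ≫ h := by
  rw [← assoc, mul_unit]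

lemma mul_succ_incl (m : ℕ) : TensorAlg F ◁ (incl F m ▷ F ≫ succ F) ≫ mul F =
    (α_ (TensorAlg F) (tpow F m) F).inv ≫ (TensorAlg F ◁ incl F m ≫ mul F) ▷ F ≫ succ F := by
  apply hom_ext_right; intro n
  have h1 : (incl F n ⊗ₘ (incl F m ▷ F ≫ succ F)) ≫ mul F =
      ((α_ _ _ _).inv ≫ concat F n m ▷ F) ≫ (incl F (n + m) ▷ F ≫ succ F) := by
    rw [incl_succ, incl_succ]; exact incl_incl_mul F n (m+1)
  have h2 := incl_incl_mul F n m
  rw [MonoidalCategory.tensorHom_def, assoc] at h1 h2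
  refine h1.trans ?_
  rw [associator_inv_naturality_left_assoc, ← comp_whiskerRight_assoc, h2]
  simp

lemma mul_succ_incl_assoc (m : ℕ) {Z : D} (h : TensorAlg F ⟶ Z) :
    TensorAlg F ◁ (incl F m ▷ F ≫ succ F) ≫ mul F ≫ h =
      (α_ (TensorAlg F) (tpow F m) F).inv ≫
        (TensorAlg F ◁ incl F m ≫ mul F) ▷ F ≫ succ F ≫ h := by
  rw [← assoc, mul_succ_incl, assoc, assoc]

lemma mul_succ : TensorAlg F ◁ succ F ≫ mul F =
    (α_ (TensorAlg F) (TensorAlg F) F).inv ≫ mul F ▷ F ≫ succ F := by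
  apply hom_ext_mid
  intro n
  rw [← MonoidalCategory.whiskerLeft_comp_assoc, mul_succ_incl]
  simp

lemma unit_mul : unit F ▷ TensorAlg F ≫ mul F = (λ_ (TensorAlg F)).hom := by
  apply ext_ind_left
  · rw [whisker_exchange_assoc, mul_unit, rightUnitor_naturality, leftUnitor_naturality,
      unitors_equal]
  · intro n ih
    rw [whisker_exchange_assoc, mul_succ_incl, associator_inv_naturality_left_assoc,
      ← comp_whiskerRight_assoc, ← whisker_exchange_assoc, ih]
    simp

lemma mul_assoc' : mul F ▷ TensorAlg F ≫ mul F =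
    (α_ _ _ _).hom ≫ TensorAlg F ◁ mul F ≫ mul F := by
  apply ext_ind_left
  · rw [whisker_exchange_assoc, mul_unit, tensor_whiskerLeft_assoc, Iso.inv_hom_id_assoc,
      ← MonoidalCategory.whiskerLeft_comp_assoc, mul_unit]
    simp
  · intro n ih
    rw [whisker_exchange_assoc, mul_succ_incl, tensor_whiskerLeft_assoc, Iso.inv_hom_id_assoc,
      ← MonoidalCategory.whiskerLeft_comp_assoc, mul_succ_incl, associator_inv_naturality_left_assoc,
      ← comp_whiskerRight_assoc, ← whisker_exchange_assoc, ih]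
    simp [mul_succ]

@[simps]
instance : MonObj (TensorAlg F) where
  one := unit F
  mul := mul F
  one_mul := unit_mul F
  mul_one := mul_unit F
  mul_assoc := mul_assoc' F

/-- The embedding `ι : F ⟶ T(F)` of the generating object. -/
def gen : F ⟶ TensorAlg F := (λ_ F).inv ≫ incl F 1

lemma gen_eq : gen F = (λ_ F).inv ≫ unit F ▷ F ≫ succ F := by
  have := incl_succ F 0
  rw [gen]
  exact congrArg ((λ_ F).inv ≫ ·) this.symm

lemma mul_gen : TensorAlg F ◁ gen F ≫ mul F = succ F := by
  have h : TensorAlg F ◁ (unit F ▷ F ≫ succ F) ≫ mul F = _ := mul_succ_incl F 0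
  change _ =  (α_ (TensorAlg F) (𝟙_ D) F).inv ≫ (TensorAlg F ◁ unit F ≫ mul F) ▷ F ≫ succ F at h
  rw [gen_eq, MonoidalCategory.whiskerLeft_comp_assoc, h, mul_unit]
  simp

section Lift

variable {F} {A : D} [MonObj A]

/-- The components `f ⊗ ⋯ ⊗ f` followed by iterated multiplication. -/
def powMap (f : F ⟶ A) : ∀ n, tpow F n ⟶ A
  | 0 => η[A]
  | n + 1 => (powMap f n ⊗ₘ f) ≫ μ[A]

/-- The algebra morphism `T(F) → A` induced by `f : F → A`. -/
def lift (f : F ⟶ A) : TensorAlg F ⟶ A := desc (powMap f)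

@[simp]
lemma unit_lift (f : F ⟶ A) : unit F ≫ lift f = η[A] := incl_desc _ 0

@[simp]
lemma succ_lift (f : F ⟶ A) : succ F ≫ lift f = (lift f ⊗ₘ f) ≫ μ[A] := by
  apply hom_ext_right
  intro n
  have h : (incl F n ▷ F ≫ succ F) ≫ lift f = ((incl F n ≫ lift f) ⊗ₘ f) ≫ μ[A] := by
    rw [incl_succ]
    refine (incl_desc (powMap f) (n+1)).trans ?_
    rw [lift, incl_desc]
    rfl
  rw [assoc] at h
  rw [h]
  simp [MonoidalCategory.tensorHom_def]

@[simp]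
lemma gen_lift (f : F ⟶ A) : gen F ≫ lift f = f := by
  rw [gen_eq, assoc, assoc, succ_lift, MonoidalCategory.tensorHom_def, assoc,
    ← comp_whiskerRight_assoc, unit_lift]
  rw [← whisker_exchange_assoc]
  simp

lemma mul_mul_hom {X Y Z : D} (a : X ⟶ A) (b : Y ⟶ A) (c : Z ⟶ A) :
    ((a ⊗ₘ b) ≫ μ[A] ⊗ₘ c) ≫ μ[A] =
      (α_ X Y Z).hom ≫ (a ⊗ₘ ((b ⊗ₘ c) ≫ μ[A])) ≫ μ[A] := by
  have h1 : ((a ⊗ₘ b) ≫ μ[A] ⊗ₘ c) = ((a ⊗ₘ b) ⊗ₘ c) ≫ μ[A] ▷ A := by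
    rw [tensorHom_comp_whiskerRight]
  have h2 : (a ⊗ₘ ((b ⊗ₘ c) ≫ μ[A])) = (a ⊗ₘ (b ⊗ₘ c)) ≫ A ◁ μ[A] := by
    rw [tensorHom_comp_whiskerLeft]
  rw [h1, h2, assoc, assoc, MonObj.mul_assoc, associator_naturality_assoc]

instance (f : F ⟶ A) : IsMonHom (lift f) where
  one_hom := unit_lift f
  mul_hom := by
    change mul F ≫ _ = _
    apply ext_ind_left
    · rw [mul_unit_assoc, MonoidalCategory.tensorHom_def', assoc, ← MonoidalCategory.whiskerLeft_comp_assoc,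
        unit_lift]
      rw [whisker_exchange_assoc]
      simp
    · intro n ih
      have h1 : TensorAlg F ◁ (incl F n ▷ F ≫ succ F) ≫ (lift f ⊗ₘ lift f) =
          lift f ⊗ₘ (((incl F n ≫ lift f) ⊗ₘ f) ≫ μ[A]) := by
        rw [MonoidalCategory.whiskerLeft_comp_tensorHom, assoc, succ_lift, whiskerRight_comp_tensorHom_assoc]
      have h2 : TensorAlg F ◁ incl F n ≫ (lift f ⊗ₘ lift f) = lift f ⊗ₘ (incl F n ≫ lift f) := by
        rw [MonoidalCategory.whiskerLeft_comp_tensorHom]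
      rw [reassoc_of% h1]
      rw [reassoc_of% h2] at ih
      rw [mul_succ_incl_assoc, succ_lift, MonoidalCategory.tensorHom_def (lift f) f, assoc,
        ← comp_whiskerRight_assoc, assoc, ih, ← MonoidalCategory.tensorHom_def_assoc,
        mul_mul_hom, Iso.inv_hom_id_assoc]

lemma algHom_ext {f g : TensorAlg F ⟶ A} [IsMonHom f] [IsMonHom g]
    (h : gen F ≫ f = gen F ≫ g) : f = g := by
  have hs (f : TensorAlg F ⟶ A) [IsMonHom f] : succ F ≫ f = f ▷ F ≫ A ◁ (gen F ≫ f) ≫ μ[A] := by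
    rw [← mul_gen]
    have : mul F ≫ f = (f ⊗ₘ f) ≫ μ[A] := IsMonHom.mul_hom f
    rw [assoc, this]
    simp [MonoidalCategory.tensorHom_def, whisker_exchange_assoc]
  apply ext_ind
  · exact (IsMonHom.one_hom f).trans (IsMonHom.one_hom g).symm
  · intro n ih
    rw [assoc, assoc, hs, hs, h, ← comp_whiskerRight_assoc, ih]
    simp

end Lift

section Bialgebra

variable [Preadditive D] [MonoidalPreadditive D] [BraidedCategory D]

/-- The coproduct, determined by `F ↦ 1 ⊗ F + F ⊗ 1`. -/
def comul : TensorAlg F ⟶ TensorAlg F ⊗ TensorAlg F :=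
  lift ((λ_ F).inv ≫ (unit F ⊗ₘ gen F) + (ρ_ F).inv ≫ (gen F ⊗ₘ unit F))

/-- The counit, determined by `F ↦ 0`. -/
def counit : TensorAlg F ⟶ 𝟙_ D := lift (0 : F ⟶ 𝟙_ D)

instance : IsMonHom (comul F) := inferInstanceAs (IsMonHom (lift _))
instance : IsMonHom (counit F) := inferInstanceAs (IsMonHom (lift _))

lemma gen_comul : gen F ≫ comul F =
    (λ_ F).inv ≫ (unit F ⊗ₘ gen F) + (ρ_ F).inv ≫ (gen F ⊗ₘ unit F) := gen_lift _

lemma gen_comul_assoc {Z : D} (h : TensorAlg F ⊗ TensorAlg F ⟶ Z) :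
    gen F ≫ comul F ≫ h =
      ((λ_ F).inv ≫ (unit F ⊗ₘ gen F) + (ρ_ F).inv ≫ (gen F ⊗ₘ unit F)) ≫ h := by
  rw [← assoc, gen_comul]

@[simp]
lemma gen_counit : gen F ≫ counit F = 0 := gen_lift _

@[simp]
lemma unit_counit : unit F ≫ counit F = 𝟙 _ := unit_lift _

lemma unit_comul : unit F ≫ comul F = (λ_ (𝟙_ D)).inv ≫ (unit F ⊗ₘ unit F) := unit_lift _

/-- The tensor algebra as a bialgebra in the braided category `D`; the algebra structure on
`T(F) ⊗ T(F)` uses the braiding. -/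
instance : BimonObj (TensorAlg F) where
  comul := comul F
  counit := counit F
  counit_comul := by
    apply algHom_ext
    rw [gen_comul_assoc]
    simp only [Preadditive.add_comp, assoc, tensorHom_comp_whiskerRight, unit_counit, gen_counit]
    simp
  comul_counit := by
    apply algHom_ext
    rw [gen_comul_assoc]
    simp only [Preadditive.add_comp, assoc, tensorHom_comp_whiskerLeft, unit_counit, gen_counit]
    simp
  comul_assoc := by
    apply algHom_ext
    rw [gen_comul_assoc, gen_comul_assoc]
    simp only [Preadditive.add_comp, assoc, tensorHom_comp_whiskerRight_assoc, tensorHom_comp_whiskerLeft, gen_comul, unit_comul]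
    simp only [MonoidalPreadditive.tensor_add, MonoidalPreadditive.add_tensor, Preadditive.add_comp, Preadditive.comp_add, add_assoc]
    congr 1
    · monoidal
    congr 1
    · monoidal
    · monoidal
  mul_comul := IsMonHom.mul_hom (comul F)
  one_comul := IsMonHom.one_hom (comul F)
  mul_counit := IsMonHom.mul_hom (counit F)
  one_counit := IsMonHom.one_hom (counit F)

end Bialgebra

end TensorAlg
end TensorAlgebra

section HopfPairing
variable {D : Type u} [Category.{v} D] [MonoidalCategory D] [BraidedCategory D]

/-- A Hopf pairing of `H₁` and `H₂`, in the nested convention: in Sweedler notation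
`ρ(h h', k) = ρ(h', k₁) ρ(h, k₂)` and `ρ(h, k k') = ρ(h₂, k) ρ(h₁, k')`, and the units and counits
are dual to each other. Compatibility with antipodes is a consequence when these exist, so only
the bialgebra structures enter. -/
structure HopfPairing (H₁ H₂ : D) [BimonObj H₁] [BimonObj H₂] where
  hom : H₁ ⊗ H₂ ⟶ 𝟙_ D
  mul_left : μ[H₁] ▷ H₂ ≫ hom = (H₁ ⊗ H₁) ◁ Δ[H₂] ≫ nest hom hom
  one_left : η[H₁] ▷ H₂ ≫ hom = (λ_ H₂).hom ≫ ε[H₂]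
  mul_right : H₁ ◁ μ[H₂] ≫ hom = Δ[H₁] ▷ (H₂ ⊗ H₂) ≫ nest hom hom
  one_right : H₁ ◁ η[H₂] ≫ hom = (ρ_ H₁).hom ≫ ε[H₁]

end HopfPairing

namespace TensorAlg
section Pairing
variable {D : Type u} [Category.{v} D] [MonoidalCategory D] [HasCoproductsOfShape ℕ D]
  [∀ Y : D, PreservesColimitsOfShape (Discrete ℕ) (tensorLeft Y)]
  [∀ Y : D, PreservesColimitsOfShape (Discrete ℕ) (tensorRight Y)]
  [Preadditive D] [MonoidalPreadditive D] [BraidedCategory D]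

variable (F : D)

/-- The projection onto degree one. -/
def proj₁ : TensorAlg F ⟶ F := desc fun n => match n with
  | 0 => 0
  | 1 => (λ_ F).hom
  | _ + 2 => 0

@[simp]
lemma unit_proj₁ : unit F ≫ proj₁ F = 0 := incl_desc _ 0

@[simp]
lemma succ_counit : succ F ≫ counit F = 0 := by
  rw [counit, succ_lift]; simp

@[simp]
lemma succ_proj₁ : succ F ≫ proj₁ F = counit F ▷ F ≫ (λ_ F).hom := by
  apply hom_ext_right
  rintro (_ | n)
  · have h : (unit F ▷ F ≫ succ F) ≫ proj₁ F = (λ_ F).hom := by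
      have : (unit F ▷ F ≫ succ F) = incl F 1 := incl_succ F 0
      rw [this]
      exact incl_desc _ 1
    rw [assoc] at h
    refine h.trans ?_
    change _ = unit F ▷ F ≫ _
    rw [← comp_whiskerRight_assoc, unit_counit]
    simp
  · have h : ((incl F n ▷ F ≫ succ F) ▷ F ≫ succ F) ≫ proj₁ F = 0 := by
      have : ((incl F n ▷ F ≫ succ F) ▷ F ≫ succ F) = incl F (n+2) := by
        rw [incl_succ]; exact incl_succ F (n+1)
      rw [this]
      exact incl_desc _ (n+2)
    have h2 : (incl F n ▷ F ≫ succ F) ▷ F ≫ counit F ▷ F ≫ (λ_ F).hom = 0 := by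
      rw [← comp_whiskerRight_assoc]; simp
    rw [assoc] at h
    rw [incl_succ] at h h2
    exact h.trans h2.symm

@[simp]
lemma gen_proj₁ : gen F ≫ proj₁ F = 𝟙 F := by
  rw [gen_eq, assoc, assoc, succ_proj₁, ← comp_whiskerRight_assoc, unit_counit]
  simp

lemma mul_counit' : mul F ≫ counit F = (counit F ⊗ₘ counit F) ≫ (λ_ (𝟙_ D)).hom :=
  IsMonHom.mul_hom (counit F)

lemma mul_proj₁ : mul F ≫ proj₁ F =
    counit F ▷ TensorAlg F ≫ (λ_ _).hom ≫ proj₁ F + TensorAlg F ◁ counit F ≫ (ρ_ _).hom ≫ proj₁ F := by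
  apply ext_ind_left
  · rw [mul_unit_assoc, Preadditive.comp_add, whisker_exchange_assoc,
      ← MonoidalCategory.whiskerLeft_comp_assoc]
    simp
  · intro n ih
    rw [mul_succ_incl_assoc]
    have h1 : TensorAlg F ◁ (incl F n ▷ F ≫ succ F) ≫ TensorAlg F ◁ counit F = 0 := by
      rw [← MonoidalCategory.whiskerLeft_comp, assoc, succ_counit]; simp
    have h2 : TensorAlg F ◁ (incl F n ▷ F ≫ succ F) ≫ counit F ▷ TensorAlg F ≫
        (λ_ (TensorAlg F)).hom ≫ proj₁ F =
        counit F ▷ (tpow F n ⊗ F) ≫ (λ_ _).hom ≫ (incl F n ≫ counit F) ▷ F ≫ (λ_ F).hom := by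
      rw [whisker_exchange_assoc, leftUnitor_naturality_assoc]
      simp
    rw [Preadditive.comp_add, reassoc_of% h1, h2, zero_comp, add_zero, succ_proj₁,
      ← comp_whiskerRight_assoc, assoc, mul_counit', MonoidalCategory.tensorHom_def', assoc,
      ← MonoidalCategory.whiskerLeft_comp_assoc]
    rw [whisker_exchange_assoc]
    simp

variable {F} {G : D} (b : F ⊗ G ⟶ 𝟙_ D)

/-- The restriction of the extended pairing to `F ⊗ T(G)`: project to degree one, then apply `b`. -/
def genPairing : F ⊗ TensorAlg G ⟶ 𝟙_ D := F ◁ proj₁ G ≫ b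

/-- The restriction of the extended pairing to `F^{⊗ n} ⊗ T(G)`. -/
def extAux : ∀ n, tpow F n ⊗ TensorAlg G ⟶ 𝟙_ D
  | 0 => (λ_ _).hom ≫ counit G
  | n + 1 => conv (extAux n) (genPairing b)

/-- The morphism underlying the extended pairing. -/
def extHom : TensorAlg F ⊗ TensorAlg G ⟶ 𝟙_ D := descR _ (extAux b)

lemma unit_ext : unit F ▷ TensorAlg G ≫ extHom b = (λ_ _).hom ≫ counit G := incl_descR _ _ 0

lemma succ_ext : succ F ▷ TensorAlg G ≫ extHom b = conv (extHom b) (genPairing b) := by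
  rw [← cancel_epi (α_ (TensorAlg F) F (TensorAlg G)).inv]
  apply hom_ext_right
  intro n
  have h1 : (incl F n ▷ F ≫ succ F) ▷ TensorAlg G ≫ extHom b = conv (extAux b n) (genPairing b) := by
    rw [incl_succ]; exact incl_descR _ _ (n+1)
  have h2 : conv (extAux b n) (genPairing b) = incl F n ▷ F ▷ TensorAlg G ≫ conv (extHom b) (genPairing b) := by
    have := conv_nat (extHom b) (genPairing b) (incl F n) (𝟙 F)
    rw [tensorHom_id] at this
    rw [this, extHom, incl_descR]; simp
  rw [comp_whiskerRight_assoc] at h1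
  rw [associator_inv_naturality_left_assoc, associator_inv_naturality_left_assoc, h1, h2]

lemma nest_zero_right {A A' B B' : D} (p : A ⊗ B' ⟶ 𝟙_ D) :
    nest p (0 : A' ⊗ B ⟶ 𝟙_ D) = 0 := by
  simp [nest]

lemma nest_zero_left {A A' B B' : D} (q : A' ⊗ B ⟶ 𝟙_ D) :
    nest (0 : A ⊗ B' ⟶ 𝟙_ D) q = 0 := by
  simp [nest]

lemma gen_ext : gen F ▷ TensorAlg G ≫ extHom b = genPairing b := by
  rw [gen_eq, comp_whiskerRight_assoc, comp_whiskerRight_assoc, succ_ext]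
  have := conv_nat (extHom b) (genPairing b) (unit F) (𝟙 F)
  rw [tensorHom_id] at this
  rw [this, unit_ext]
  have h : conv ((λ_ (TensorAlg G)).hom ≫ counit G) (genPairing b) = _ :=
    conv_counit_left (S := TensorAlg G) (genPairing b)
  rw [id_whiskerRight, id_comp, h, ← comp_whiskerRight_assoc]
  simp

lemma unit_genPairing : F ◁ unit G ≫ genPairing b = 0 := by
  rw [genPairing, ← MonoidalCategory.whiskerLeft_comp_assoc]; simp

lemma ext_unit : TensorAlg F ◁ unit G ≫ extHom b = (ρ_ _).hom ≫ counit F := by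
  apply ext_ind_right
  · rw [← whisker_exchange_assoc, unit_ext, leftUnitor_naturality_assoc,
      rightUnitor_naturality_assoc, unit_counit, unit_counit, unitors_equal]
  · intro n ih
    have h := nest_right (extHom b) (genPairing b) (unit G) (unit G)
    have hu : unit G ≫ Δ[TensorAlg G] = _ := unit_comul G
    rw [unit_genPairing, nest_zero_right] at h
    rw [← whisker_exchange_assoc, comp_whiskerRight_assoc, succ_ext, conv,
      rightUnitor_naturality_assoc, assoc, succ_counit, whisker_exchange_assoc,
      ← MonoidalCategory.whiskerLeft_comp_assoc, hu, MonoidalCategory.whiskerLeft_comp_assoc, h]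
    simp

lemma mul_ext : mul F ▷ TensorAlg G ≫ extHom b = conv (extHom b) (extHom b) := by
  rw [← cancel_epi (α_ (TensorAlg F) (TensorAlg F) (TensorAlg G)).inv]
  have hc {A : D} (p : A ⟶ TensorAlg F) : (TensorAlg F ◁ p) ▷ TensorAlg G ≫ conv (extHom b) (extHom b) =
      conv (extHom b) (p ▷ TensorAlg G ≫ extHom b) := by
    have := conv_nat (extHom b) (extHom b) (𝟙 _) p
    rw [id_tensorHom] at this
    rw [this]; simp
  apply ext_ind_mid
  · rw [associator_inv_naturality_middle_assoc, associator_inv_naturality_middle_assoc, hc,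
      unit_ext, ← comp_whiskerRight_assoc, mul_unit]
    exact congrArg _ (conv_counit_right (S := TensorAlg G) _).symm
  · intro n ih
    rw [associator_inv_naturality_middle_assoc, associator_inv_naturality_middle_assoc, hc,
      cancel_epi, ← comp_whiskerRight_assoc] at ih
    rw [associator_inv_naturality_middle_assoc, associator_inv_naturality_middle_assoc, hc,
      comp_whiskerRight_assoc (incl F n ▷ F), succ_ext, ← comp_whiskerRight_assoc, mul_succ_incl,
      comp_whiskerRight_assoc, comp_whiskerRight_assoc, succ_ext]
    have h1 := conv_nat (extHom b) (genPairing b) (incl F n) (𝟙 F)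
    have h2 := conv_nat (extHom b) (genPairing b) (TensorAlg F ◁ incl F n ≫ mul F) (𝟙 F)
    rw [tensorHom_id] at h1 h2
    rw [h1, h2, ih, conv_assoc]
    simp

lemma gen_ext_mul : F ◁ mul G ≫ genPairing b = (gen F ≫ comul F) ▷ (TensorAlg G ⊗ TensorAlg G) ≫
    nest (extHom b) (extHom b) := by
  rw [gen_comul, MonoidalPreadditive.add_whiskerRight, Preadditive.add_comp, comp_whiskerRight_assoc,
    comp_whiskerRight_assoc, nest_left, nest_left, unit_ext, gen_ext, genPairing,
    ← MonoidalCategory.whiskerLeft_comp_assoc, mul_proj₁, MonoidalPreadditive.whiskerLeft_add,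
    Preadditive.add_comp, add_comm]
  congr 1
  · have h : (F ◁ proj₁ G ≫ b) ▷ TensorAlg G ≫ (λ_ (TensorAlg G)).hom ≫ counit G =
        (F ⊗ TensorAlg G) ◁ counit G ≫ (ρ_ _).hom ≫ F ◁ proj₁ G ≫ b := by
      rw [← leftUnitor_naturality, ← whisker_exchange_assoc, ← rightUnitor_naturality, unitors_equal]
    calc
      _ = 𝟙 _ ⊗≫ ((F ⊗ TensorAlg G) ◁ counit G ≫ (ρ_ _).hom ≫ F ◁ proj₁ G ≫ b) := by monoidal
      _ = _ := by
        rw [← h]; simp only [nest]; monoidal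
  · simp only [nest]
    monoidal

lemma mul_comul' : mul G ≫ comul G = (comul G ⊗ₘ comul G) ≫ tensorμ _ _ _ _ ≫ (mul G ⊗ₘ mul G) := by
  have := BimonObj.mul_comul (TensorAlg G)
  exact this

lemma ext_mul : TensorAlg F ◁ mul G ≫ extHom b = comul F ▷ _ ≫ nest (extHom b) (extHom b) := by
  apply ext_ind_right
  · rw [← whisker_exchange_assoc, unit_ext, leftUnitor_naturality_assoc, mul_counit',
      ← comp_whiskerRight_assoc, unit_comul, comp_whiskerRight_assoc, nest_left, unit_ext]
    have h : counit G ▷ TensorAlg G ≫ (λ_ (TensorAlg G)).hom ≫ counit G =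
        (TensorAlg G) ◁ counit G ≫ (ρ_ _).hom ≫ counit G := by
      rw [← leftUnitor_naturality, ← whisker_exchange_assoc, ← rightUnitor_naturality, unitors_equal]
    calc
      _ = 𝟙 _ ⊗≫ (TensorAlg G ◁ counit G ≫ (ρ_ _).hom ≫ counit G) := by
        rw [← h, MonoidalCategory.tensorHom_def]
        have h' : counit G ▷ TensorAlg G ≫ 𝟙_ D ◁ counit G ≫ (λ_ (𝟙_ D)).hom =
          counit G ▷ TensorAlg G ≫ (λ_ (TensorAlg G)).hom ≫ counit G := by
          rw [leftUnitor_naturality]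
        rw [← h']; monoidal
      _ = _ := by
        rw [← h]; simp only [nest]; monoidal
  · intro n ih
    have h1 : (incl F n ▷ F) ▷ _ ≫ (TensorAlg F ⊗ F) ◁ (mul G ⊗ₘ mul G) ≫
        nest (extHom b) (genPairing b) =
        ((incl F n ≫ comul F) ⊗ₘ (gen F ≫ comul F)) ▷ _ ≫
          nest (nest (extHom b) (extHom b)) (nest (extHom b) (extHom b)) := by
      rw [nest_right, nest_left, ← gen_ext_mul]
      have := nest_left (TensorAlg F ◁ mul G ≫ extHom b) (F ◁ mul G ≫ genPairing b) (incl F n) (𝟙 F)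
      rw [tensorHom_id] at this
      rw [this, ih]
      simp
    have h2 : (mul F ⊗ₘ mul F) ▷ _ ≫ nest (extHom b) (extHom b) =
        _ ◁ (comul G ⊗ₘ comul G) ≫ nest (nest (extHom b) (extHom b)) (nest (extHom b) (extHom b)) := by
      rw [nest_left, nest_right, mul_ext]; rfl
    have h3 : (incl F n ▷ F ≫ succ F) ≫ comul F = ((incl F n ≫ comul F) ⊗ₘ (gen F ≫ comul F)) ≫
        tensorμ _ _ _ _ ≫ (mul F ⊗ₘ mul F) := by
      rw [← mul_gen, assoc, assoc, mul_comul']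
      simp [MonoidalCategory.whiskerLeft_comp_tensorHom_assoc, whiskerRight_comp_tensorHom_assoc]
    have h4 : mul G ≫ comul G = (comul G ⊗ₘ comul G) ≫ tensorμ _ _ _ _ ≫ (mul G ⊗ₘ mul G) :=
      mul_comul'
    have hL : (incl F n ▷ F ≫ succ F) ▷ _ ≫ TensorAlg F ◁ mul G ≫ extHom b =
        (incl F n ▷ F) ▷ _ ≫ (TensorAlg F ⊗ F) ◁ (mul G ≫ comul G) ≫
          nest (extHom b) (genPairing b) := by
      rw [comp_whiskerRight_assoc, ← whisker_exchange_assoc, succ_ext, conv,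
        MonoidalCategory.whiskerLeft_comp_assoc]
      rfl
    have hR : (incl F n ▷ F ≫ succ F) ▷ _ ≫ comul F ▷ _ ≫ nest (extHom b) (extHom b) =
        (incl F n ▷ F) ▷ _ ≫ (TensorAlg F ⊗ F) ◁ (mul G ≫ comul G) ≫
          nest (extHom b) (genPairing b) := by
      rw [h4, MonoidalCategory.whiskerLeft_comp_assoc, MonoidalCategory.whiskerLeft_comp_assoc,
        ← whisker_exchange_assoc, ← whisker_exchange_assoc, h1, whisker_exchange_assoc,
        nest_nest, whisker_exchange_assoc, whisker_exchange_assoc, ← h2, ← comp_whiskerRight_assoc, h3,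
        comp_whiskerRight_assoc, comp_whiskerRight_assoc]
    rw [hL, hR]

/-- The Hopf pairing `ρ(b)` of `T(F)` and `T(G)` extending `b : F ⊗ G ⟶ 𝟙`. It is the only one by
`gen_gen_extPairing` and `pairing_unique`. -/
def extPairing : HopfPairing (TensorAlg F) (TensorAlg G) where
  hom := extHom b
  mul_left := mul_ext b
  one_left := unit_ext b
  mul_right := ext_mul b
  one_right := ext_unit b

lemma gen_gen_extPairing : (gen F ⊗ₘ gen G) ≫ (extPairing b).hom = b := by
  rw [MonoidalCategory.tensorHom_def']
  change (F ◁ gen G ≫ gen F ▷ TensorAlg G) ≫ extHom b = b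
  rw [assoc, gen_ext, genPairing, ← MonoidalCategory.whiskerLeft_comp_assoc, gen_proj₁]
  simp

lemma incl_gen_mul (n : ℕ) : (incl F n ⊗ₘ gen F) ≫ mul F = incl F n ▷ F ≫ succ F := by
  rw [MonoidalCategory.tensorHom_def, assoc, mul_gen]

/-- A Hopf pairing of tensor algebras is determined by its restriction to the generating objects. -/
lemma pairing_unique (P Q : HopfPairing (TensorAlg F) (TensorAlg G))
    (h : (gen F ⊗ₘ gen G) ≫ P.hom = (gen F ⊗ₘ gen G) ≫ Q.hom) : P.hom = Q.hom := by
  have hu (P : HopfPairing (TensorAlg F) (TensorAlg G)) :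
      unit F ▷ TensorAlg G ≫ P.hom = (λ_ _).hom ≫ counit G := P.one_left
  have hu' (P : HopfPairing (TensorAlg F) (TensorAlg G)) :
      TensorAlg F ◁ unit G ≫ P.hom = (ρ_ _).hom ≫ counit F := P.one_right
  have hm (P : HopfPairing (TensorAlg F) (TensorAlg G)) : mul F ▷ TensorAlg G ≫ P.hom =
    (TensorAlg F ⊗ TensorAlg F) ◁ comul G ≫ nest P.hom P.hom := P.mul_left
  have hm' (P : HopfPairing (TensorAlg F) (TensorAlg G)) : TensorAlg F ◁ mul G ≫ P.hom =
    comul F ▷ (TensorAlg G ⊗ TensorAlg G) ≫ nest P.hom P.hom := P.mul_right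
  have hg : gen F ▷ TensorAlg G ≫ P.hom = gen F ▷ TensorAlg G ≫ Q.hom := by
    apply ext_ind_left
    · rw [whisker_exchange_assoc, whisker_exchange_assoc, hu', hu']
    · intro n ih
      have key (P : HopfPairing (TensorAlg F) (TensorAlg G)) :
          F ◁ (incl G n ▷ G ≫ succ G) ≫ gen F ▷ TensorAlg G ≫ P.hom =
          (λ_ F).inv ▷ (tpow G n ⊗ G) ≫ nest (𝟙_ D ◁ gen G ≫ unit F ▷ TensorAlg G ≫ P.hom)
              (F ◁ incl G n ≫ gen F ▷ TensorAlg G ≫ P.hom) +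
          (ρ_ F).inv ▷ (tpow G n ⊗ G) ≫ nest ((gen F ⊗ₘ gen G) ≫ P.hom)
              (𝟙_ D ◁ incl G n ≫ unit F ▷ TensorAlg G ≫ P.hom) := by
        rw [← incl_gen_mul, MonoidalCategory.whiskerLeft_comp, assoc, whisker_exchange_assoc, hm',
          whisker_exchange_assoc, whisker_exchange_assoc, ← comp_whiskerRight_assoc, nest_right, gen_comul, MonoidalPreadditive.add_whiskerRight,
          Preadditive.add_comp, comp_whiskerRight_assoc, comp_whiskerRight_assoc, nest_left, nest_left,
          whisker_exchange_assoc, whisker_exchange_assoc, whisker_exchange_assoc,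
          MonoidalCategory.tensorHom_def, assoc]
      rw [key, key, ih, h, hu, hu]
  apply ext_ind_right
  · rw [hu, hu]
  · intro n ih
    have key (P : HopfPairing (TensorAlg F) (TensorAlg G)) :
        (incl F n ▷ F ≫ succ F) ▷ TensorAlg G ≫ P.hom = (tpow F n ⊗ F) ◁ comul G ≫
          nest (incl F n ▷ TensorAlg G ≫ P.hom) (gen F ▷ TensorAlg G ≫ P.hom) := by
      rw [← incl_gen_mul, comp_whiskerRight_assoc, hm, ← whisker_exchange_assoc, nest_left]
    rw [key, key, ih, hg]

end Pairing
end TensorAlg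

section RightModule

variable {D : Type u} [Category.{v} D] [MonoidalCategory D]

/-- A right action of the algebra `A` on the object `X`. -/
structure RightAction (A : D) [MonObj A] (X : D) where
  act : X ⊗ A ⟶ X
  act_one : X ◁ η[A] ≫ act = (ρ_ X).hom
  act_mul : X ◁ μ[A] ≫ act = (α_ X A A).inv ≫ act ▷ A ≫ act

/-- A triple `(X, m₁, m₂)`, where `m₁` is a left action of `H₁` on `X` and `m₂` a right action of
`H₂` on `X`, is a Yetter-Drinfeld module with respect to the Hopf pairing `P` if the following two
morphisms `H₁ ⊗ (X ⊗ H₂) ⟶ X` agree. In Sweedler notation the first one is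
`h ⊗ x ⊗ k ↦ h₁ (x k₁) ρ(h₂, k₂)`, where `h₂` is moved past `x k₁` by the braiding
`H₁ ⊗ X ⟶ X ⊗ H₁`, and the second one is `h ⊗ x ⊗ k ↦ ρ(h₁, k₁) (h₂ x) k₂`, where `k₁` is moved
past `h₂ x` by the braiding `X ⊗ H₂ ⟶ H₂ ⊗ X`. -/
def IsYetterDrinfeld [BraidedCategory D] {H₁ H₂ : D} [BimonObj H₁] [BimonObj H₂]
    (P : HopfPairing H₁ H₂) {X : D} (m₁ : ModObj H₁ X) (m₂ : RightAction H₂ X) : Prop :=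
  (Δ[H₁] ⊗ₘ (X ◁ Δ[H₂])) ≫ (α_ H₁ H₁ (X ⊗ (H₂ ⊗ H₂))).hom ≫
      H₁ ◁ (H₁ ◁ ((α_ X H₂ H₂).inv ≫ m₂.act ▷ H₂) ≫
        (α_ H₁ X H₂).inv ≫ (β_ H₁ X).hom ▷ H₂ ≫ (α_ X H₁ H₂).hom ≫ X ◁ P.hom ≫ (ρ_ X).hom) ≫
      m₁.smul =
  (Δ[H₁] ⊗ₘ (X ◁ Δ[H₂])) ≫ (α_ H₁ H₁ (X ⊗ (H₂ ⊗ H₂))).hom ≫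
      H₁ ◁ ((α_ H₁ X (H₂ ⊗ H₂)).inv ≫ m₁.smul ▷ (H₂ ⊗ H₂) ≫
        (α_ X H₂ H₂).inv ≫ (β_ X H₂).hom ▷ H₂ ≫ (α_ H₂ X H₂).hom) ≫
      (α_ H₁ H₂ (X ⊗ H₂)).inv ≫ P.hom ▷ (X ⊗ H₂) ≫ (λ_ (X ⊗ H₂)).hom ≫ m₂.act

end RightModule

section ActionCategory

variable {D : Type u} [Category.{v} D] [MonoidalCategory D]

/-- Objects of the category `D_F` attached to an object `F` of the monoidal centre: an object `X`
together with an arbitrary morphism `m : F ⊗ X ⟶ X`. -/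
structure CatOver (F : Center D) where
  X : D
  m : F.1 ⊗ X ⟶ X

namespace CatOver

/-- A morphism `(X, m) ⟶ (Y, n)` in `D_F`. -/
@[ext]
structure Hom {F : Center D} (M N : CatOver F) where
  f : M.X ⟶ N.X
  comm : F.1 ◁ f ≫ N.m = M.m ≫ f

instance (F : Center D) : Category (CatOver F) where
  Hom := Hom
  id M := ⟨𝟙 M.X, by simp⟩
  comp f g := ⟨f.f ≫ g.f, by
    rw [MonoidalCategory.whiskerLeft_comp, assoc, g.comm, ← assoc, f.comm, assoc]⟩
  id_comp f := Hom.ext (id_comp f.f)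
  comp_id f := Hom.ext (comp_id f.f)
  assoc f g h := Hom.ext (assoc f.f g.f h.f)

end CatOver

/-- The embedding `ι⁻` of a braided category into its centre, on objects: the half-braiding
`F ⊗ X ⟶ X ⊗ F` is the inverse of the braiding `X ⊗ F ⟶ F ⊗ X`. -/
def ofBraidedRevObj [BraidedCategory D] (F : D) : Center D :=
  ⟨F,
    { β := fun X => (β_ X F).symm
      monoidal := fun X Y => by simp
      naturality := fun f => by simp }⟩

section DirectSum

variable [Preadditive D] [MonoidalPreadditive D] [HasBinaryBiproducts D]

lemma whisker_inl_fst {A B : D} (U : D) {Z : D} (h : A ⊗ U ⟶ Z) :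
    (biprod.inl : A ⟶ A ⊞ B) ▷ U ≫ (biprod.fst : A ⊞ B ⟶ A) ▷ U ≫ h = h := by
  rw [← comp_whiskerRight_assoc]; simp

lemma whisker_inr_snd {A B : D} (U : D) {Z : D} (h : B ⊗ U ⟶ Z) :
    (biprod.inr : B ⟶ A ⊞ B) ▷ U ≫ (biprod.snd : A ⊞ B ⟶ B) ▷ U ≫ h = h := by
  rw [← comp_whiskerRight_assoc]; simp

lemma whisker_inl_snd {A B : D} (U : D) {Z : D} (h : B ⊗ U ⟶ Z) :
    (biprod.inl : A ⟶ A ⊞ B) ▷ U ≫ (biprod.snd : A ⊞ B ⟶ B) ▷ U ≫ h = 0 := by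
  rw [← comp_whiskerRight_assoc]; simp

lemma whisker_inr_fst {A B : D} (U : D) {Z : D} (h : A ⊗ U ⟶ Z) :
    (biprod.inr : B ⟶ A ⊞ B) ▷ U ≫ (biprod.fst : A ⊞ B ⟶ A) ▷ U ≫ h = 0 := by
  rw [← comp_whiskerRight_assoc]; simp

/-- The direct sum of two objects of the centre: the half-braiding is the direct sum of the two
half-braidings. -/
def centerSum (A B : Center D) : Center D :=
  ⟨A.1 ⊞ B.1,
    { β := fun U =>
        { hom := biprod.fst ▷ U ≫ (A.2.β U).hom ≫ U ◁ biprod.inl +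
            biprod.snd ▷ U ≫ (B.2.β U).hom ≫ U ◁ biprod.inr
          inv := U ◁ biprod.fst ≫ (A.2.β U).inv ≫ biprod.inl ▷ U +
            U ◁ biprod.snd ≫ (B.2.β U).inv ≫ biprod.inr ▷ U
          hom_inv_id := by
            simp [← MonoidalCategory.whiskerLeft_comp_assoc, ← comp_whiskerRight,
              ← MonoidalPreadditive.add_whiskerRight]
          inv_hom_id := by
            simp [← MonoidalCategory.whiskerLeft_comp, ← comp_whiskerRight_assoc,
              ← MonoidalPreadditive.whiskerLeft_add] }
      monoidal := fun U V => by
        have h {A' B' Z : D} (f : A' ⟶ A.1 ⊞ B.1) (g : A.1 ⊞ B.1 ⟶ B') (h : U ⊗ B' ⊗ V ⟶ Z) :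
            U ◁ f ▷ V ≫ U ◁ g ▷ V ≫ h = U ◁ (f ≫ g) ▷ V ≫ h := by simp
        simp [HalfBraiding.monoidal, h]
      naturality := fun {U V} f => by
        simp [whisker_exchange_assoc, whisker_exchange, HalfBraiding.naturality_assoc] }⟩

/-- The canonical embedding of the first summand, as a morphism in the centre. -/
def centerInl (A B : Center D) : A ⟶ centerSum A B where
  f := (biprod.inl : A.1 ⟶ A.1 ⊞ B.1)
  comm U := by
    simp [centerSum, whisker_inl_fst, whisker_inl_snd]

/-- The canonical embedding of the second summand, as a morphism in the centre. -/
def centerInr (A B : Center D) : B ⟶ centerSum A B where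
  f := (biprod.inr : B.1 ⟶ A.1 ⊞ B.1)
  comm U := by
    simp [centerSum, whisker_inr_fst, whisker_inr_snd]

end DirectSum

/-- The half-braiding of the tensor product `A ⊗ B` in the centre, between the underlying objects. -/
def tensorHalfBraiding (A B : Center D) (X : D) : (A.1 ⊗ B.1) ⊗ X ⟶ X ⊗ (A.1 ⊗ B.1) :=
  ((A ⊗ B : Center D).2.β X).hom

lemma tensorHalfBraiding_eq (A B : Center D) (X : D) : tensorHalfBraiding A B X =
    (α_ _ _ _).hom ≫ A.1 ◁ (B.2.β X).hom ≫ (α_ _ _ _).inv ≫ (A.2.β X).hom ▷ B.1 ≫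
      (α_ _ _ _).hom := rfl

section Commutation

variable [Preadditive D] [MonoidalPreadditive D] [HasBinaryBiproducts D]

/-- The restriction of the morphism `m` of an object `(X, m)` of `D_{A ⊕ B}` to `A ⊗ X`. -/
def CatOver.restrictInl {A B : Center D} (M : CatOver (centerSum A B)) : A.1 ⊗ M.X ⟶ M.X :=
  (centerInl A B).f ▷ M.X ≫ M.m

/-- The restriction of the morphism `m` of an object `(X, m)` of `D_{A ⊕ B}` to `B ⊗ X`. -/
def CatOver.restrictInr {A B : Center D} (M : CatOver (centerSum A B)) : B.1 ⊗ M.X ⟶ M.X :=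
  (centerInr A B).f ▷ M.X ≫ M.m

/-- The commutation condition with `b` for an object `(X, m)` of `D_{A ⊕ B}`, an identity of
morphisms `(A ⊗ B) ⊗ X ⟶ X`. Here `A.2.β` is the half-braiding of `A`. The morphism `b` is a morphism of the
underlying objects and need not be compatible with the half-braidings. -/
def CatOver.SatisfiesCommutation {A B : Center D} (M : CatOver (centerSum A B))
    (b : A.1 ⊗ B.1 ⟶ 𝟙_ D) : Prop :=
  (α_ A.1 B.1 M.X).hom ≫ A.1 ◁ M.restrictInr ≫ M.restrictInl -
      (A.2.β B.1).hom ▷ M.X ≫ (α_ B.1 A.1 M.X).hom ≫ B.1 ◁ M.restrictInl ≫ M.restrictInr =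
    b ▷ M.X ≫ (λ_ M.X).hom -
      tensorHalfBraiding A B M.X ≫ M.X ◁ b ≫ (ρ_ M.X).hom

/-- The object `(X, m)` of `D_F`, `F = ι⁺(F⁺) ⊕ ι⁻(F⁻)`, defined by a left action `m₊` of `T(F⁺)` and
a right action `m₋` of `T(F⁻)` on `X`: on `F⁺ ⊗ X` the morphism `m` is the restriction of `m₊`, and
on `F⁻ ⊗ X` it is the restriction of `m₋` precomposed with the inverse of the braiding
`X ⊗ F⁻ ⟶ F⁻ ⊗ X`. -/
def inducedObj [BraidedCategory D] [HasCoproductsOfShape ℕ D]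
    [∀ Y : D, PreservesColimitsOfShape (Discrete ℕ) (tensorLeft Y)]
    [∀ Y : D, PreservesColimitsOfShape (Discrete ℕ) (tensorRight Y)]
    {Fp Fm X : D} (mp : ModObj (TensorAlg Fp) X) (mm : RightAction (TensorAlg Fm) X) :
    CatOver (centerSum (Center.ofBraidedObj Fp) (ofBraidedRevObj Fm)) where
  X := X
  m := (biprod.fst : Fp ⊞ Fm ⟶ Fp) ▷ X ≫ TensorAlg.gen Fp ▷ X ≫ mp.smul +
    (biprod.snd : Fp ⊞ Fm ⟶ Fm) ▷ X ≫ (β_ X Fm).inv ≫ X ◁ TensorAlg.gen Fm ≫ mm.act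

end Commutation


end ActionCategory

end TensorHopf

end

/-! Write H₁ = T(F⁺) and H₂ = T(F⁻), use Sweedler notation and suppress braidings. The
Yetter-Drinfeld condition compares two morphisms H₁ ⊗ X ⊗ H₂ ⟶ X, `ydLeft` and `ydRight`, and the
point is that it suffices to compare them on F⁺ ⊗ X ⊗ F⁻. The sides themselves are not
multiplicative in h or k, so the condition is first recast as linearity of a morphism between
modules, which can be tested on algebra generators.

The pairing makes H₂ a left H₁-module by h·k = ρ(h, k₁) k₂, and H₁ a right H₂-module by h·k = h₁
ρ(h₂, k). Consider k ⊗ x ↦ x k₁ ⊗ k₂ from H₂ ⊗ X to X ⊗ H₂. Its two composites with the action of H₁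
are h ⊗ x ⊗ k ↦ f(h, x, k₁) ⊗ k₂ with f = `ydLeft` and f = `ydRight` (`shearRight_tensor_act`,
`tensor_act_shearRight`). The counit recovers f, so the Yetter-Drinfeld condition says that this
morphism is H₁-linear. In the same way it says that x ⊗ h ↦ h₁ ⊗ h₂ x is H₂-linear
(`shearLeft_tensor_act`, `tensor_act_shearLeft`).

Linearity over H₁ passes from generators of H₁ to all of H₁ while the H₂-variable stays in F⁻
(`yd_gen_right`). This needs care, since F⁻ ⊗ X is not a submodule of H₂ ⊗ X: a generator f sends g
⊗ x to b(f, g) 1 ⊗ x plus a term in F⁻ ⊗ X. On 1 ⊗ X, however, linearity is automatic. Linearity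
over H₂ then passes from F⁻ to all of H₂ (`ydLeft_eq_ydRight`).

On generators the coproducts are primitive, and each side has two surviving terms, one containing b
and one composing the two actions (`gen_gen_sides`). The resulting identity is the commutation
condition after precomposition with an isomorphism built from the braiding of X and F⁻
(`satisfiesCommutation_iff`). No antipode is used. -/

noncomputable section

namespace TensorHopf


/-! ### Tensor products of modules over a bialgebra in a braided category -/

section TensorProductAction

variable {D : Type u} [Category.{v} D] [MonoidalCategory D]

/-- A left action of the algebra `A` on the object `X`. -/
structure LeftAction (A : D) [MonObj A] (X : D) where
  act : A ⊗ X ⟶ X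
  one_act : η[A] ▷ X ≫ act = (λ_ X).hom
  mul_act : μ[A] ▷ X ≫ act = (α_ A A X).hom ≫ A ◁ act ≫ act

/-- The left action underlying a module object. -/
def LeftAction.ofModObj {A : D} [MonObj A] {X : D} (m : ModObj A X) : LeftAction A X where
  act := m.smul
  one_act := m.one_smul
  mul_act := m.mul_smul

variable [BraidedCategory D] {H X Y : D} [BimonObj H]

/-- The tensor product of two left actions of a bialgebra. -/
def LeftAction.tensor (a : LeftAction H X) (b : LeftAction H Y) : LeftAction H (X ⊗ Y) where
  act := Δ[H] ▷ (X ⊗ Y) ≫ tensorμ H H X Y ≫ (a.act ⊗ₘ b.act)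
  one_act := by
    rw [← comp_whiskerRight_assoc, BimonObj.one_comul,
      MonObj.tensorObj.one_def, comp_whiskerRight_assoc,
      tensorμ_natural_left_assoc, tensorHom_comp_tensorHom, a.one_act, b.one_act]
    exact (tensor_left_unitality X Y).symm
  mul_act := by
    -- Compatibility of Δ with μ leaves a statement about reordering six strands, which is the
    -- associativity coherence of `tensorμ`.
    have h := tensor_associativity H H H H X Y
    rw [← comp_whiskerRight_assoc, BimonObj.mul_comul, comp_whiskerRight_assoc,
      comp_whiskerRight_assoc, tensorμ_natural_left_assoc, tensorHom_comp_tensorHom, a.mul_act,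
      b.mul_act, ← tensorHom_comp_tensorHom, reassoc_of% h, ← tensorHom_comp_tensorHom,
      ← tensorμ_natural_right_assoc, MonoidalCategory.tensorHom_def Δ[H] Δ[H],
      comp_whiskerRight_assoc, associator_naturality_middle_assoc,
      associator_naturality_left_assoc, whisker_exchange_assoc]
    simp only [MonoidalCategory.whiskerLeft_comp, assoc]

/-- The tensor product of two right actions of a bialgebra. -/
def RightAction.tensor (a : RightAction H X) (b : RightAction H Y) : RightAction H (X ⊗ Y) where
  act := (X ⊗ Y) ◁ Δ[H] ≫ tensorμ X Y H H ≫ (a.act ⊗ₘ b.act)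
  act_one := by
    rw [← MonoidalCategory.whiskerLeft_comp_assoc, BimonObj.one_comul,
      MonObj.tensorObj.one_def, MonoidalCategory.whiskerLeft_comp_assoc,
      tensorμ_natural_right_assoc, tensorHom_comp_tensorHom, a.act_one, b.act_one]
    exact (tensor_right_unitality X Y).symm
  act_mul := by
    have h := tensor_associativity X Y H H H H
    have h' : (X ⊗ Y) ◁ tensorμ H H H H ≫ tensorμ X Y (H ⊗ H) (H ⊗ H) =
        (α_ _ _ _).inv ≫ tensorμ X Y H H ▷ (H ⊗ H) ≫ tensorμ (X ⊗ H) (Y ⊗ H) H H ≫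
        ((α_ X H H).hom ⊗ₘ (α_ Y H H).hom) := by
      rw [h]; simp
    rw [← MonoidalCategory.whiskerLeft_comp_assoc, BimonObj.mul_comul,
      MonoidalCategory.whiskerLeft_comp_assoc,
      MonoidalCategory.whiskerLeft_comp_assoc, tensorμ_natural_right_assoc,
      tensorHom_comp_tensorHom, a.act_mul,
      b.act_mul, reassoc_of% h', ← tensorHom_comp_tensorHom, tensorHom_comp_tensorHom_assoc,
      Iso.hom_inv_id, Iso.hom_inv_id, ← tensorHom_comp_tensorHom, id_tensorHom_id, id_comp,
      ← tensorμ_natural_left_assoc, MonoidalCategory.tensorHom_def' Δ[H] Δ[H],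
      MonoidalCategory.whiskerLeft_comp_assoc, associator_inv_naturality_middle_assoc,
      associator_inv_naturality_right_assoc, ← whisker_exchange_assoc]
    simp only [comp_whiskerRight, assoc]

end TensorProductAction

/-! ### The actions of H₁ on H₂ and of H₂ on H₁ given by a Hopf pairing -/

section PairingAction

variable {D : Type u} [Category.{v} D] [MonoidalCategory D] [BraidedCategory D]
  {H₁ H₂ : D} [BimonObj H₁] [BimonObj H₂] (P : HopfPairing H₁ H₂)

/-- The left action `h ⊗ k ↦ ρ(h, k₁) k₂` of `H₁` on `H₂` defined by a Hopf pairing. -/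
def HopfPairing.leftAction : LeftAction H₁ H₂ where
  act := H₁ ◁ Δ[H₂] ≫ (α_ _ _ _).inv ≫ P.hom ▷ H₂ ≫ (λ_ H₂).hom
  one_act := by
    rw [← whisker_exchange_assoc, associator_inv_naturality_left_assoc,
      ← comp_whiskerRight_assoc, P.one_left]
    calc
      _ = (λ_ H₂).hom ≫ (Δ[H₂] ≫ ε[H₂] ▷ H₂) ≫ (λ_ H₂).hom := by monoidal
      _ = _ := by rw [ComonObj.counit_comul]; simp
  mul_act := by
    -- The nested convention gives (h h')·k = ρ(h', k₁) ρ(h, k₂) k₃, which is h·(h'·k) by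
    -- coassociativity, without any crossing of strands.
    rw [← whisker_exchange_assoc, associator_inv_naturality_left_assoc,
      ← comp_whiskerRight_assoc, P.mul_left]
    calc
      _ = 𝟙 _ ⊗≫ (H₁ ⊗ H₁) ◁ (Δ[H₂] ≫ Δ[H₂] ▷ H₂) ⊗≫ nest P.hom P.hom ▷ H₂ ⊗≫ 𝟙 _ := by monoidal
      _ = 𝟙 _ ⊗≫ (H₁ ⊗ H₁) ◁ (Δ[H₂] ≫ H₂ ◁ Δ[H₂]) ⊗≫ nest P.hom P.hom ▷ H₂ ⊗≫ 𝟙 _ := by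
        rw [ComonObj.comul_assoc_flip]; monoidal
      _ = 𝟙 _ ⊗≫ (H₁ ⊗ H₁) ◁ Δ[H₂] ⊗≫ H₁ ◁ ((H₁ ⊗ H₂) ◁ Δ[H₂] ≫ P.hom ▷ (H₂ ⊗ H₂)) ⊗≫ P.hom ▷ H₂ ⊗≫ 𝟙 _ := by
        simp only [nest]; monoidal
      _ = _ := by
        rw [whisker_exchange]; monoidal

/-- The right action `h ⊗ k ↦ h₁ ρ(h₂, k)` of `H₂` on `H₁` defined by a Hopf pairing. -/
def HopfPairing.rightAction : RightAction H₂ H₁ where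
  act := Δ[H₁] ▷ H₂ ≫ (α_ _ _ _).hom ≫ H₁ ◁ P.hom ≫ (ρ_ H₁).hom
  act_one := by
    rw [whisker_exchange_assoc, associator_naturality_right_assoc,
      ← MonoidalCategory.whiskerLeft_comp_assoc, P.one_right]
    calc
      _ = (ρ_ H₁).hom ≫ (Δ[H₁] ≫ H₁ ◁ ε[H₁]) ≫ (ρ_ H₁).hom := by monoidal
      _ = _ := by rw [ComonObj.comul_counit]; simp
  act_mul := by
    -- Here h·(k k') = h₁ ρ(h₂, k') ρ(h₃, k) = (h·k)·k', again by nesting and coassociativity.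
    rw [whisker_exchange_assoc, associator_naturality_right_assoc,
      ← MonoidalCategory.whiskerLeft_comp_assoc, P.mul_right]
    calc
      _ = 𝟙 _ ⊗≫ (Δ[H₁] ≫ H₁ ◁ Δ[H₁]) ▷ (H₂ ⊗ H₂) ⊗≫ H₁ ◁ nest P.hom P.hom ⊗≫ 𝟙 _ := by monoidal
      _ = 𝟙 _ ⊗≫ (Δ[H₁] ≫ Δ[H₁] ▷ H₁) ▷ (H₂ ⊗ H₂) ⊗≫ H₁ ◁ nest P.hom P.hom ⊗≫ 𝟙 _ := by
        rw [ComonObj.comul_assoc_flip]; monoidal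
      _ = 𝟙 _ ⊗≫ Δ[H₁] ▷ (H₂ ⊗ H₂) ⊗≫ (Δ[H₁] ▷ (H₁ ⊗ H₂) ≫ (H₁ ⊗ H₁) ◁ P.hom) ▷ H₂ ⊗≫ H₁ ◁ P.hom ⊗≫ 𝟙 _ := by
        simp only [nest]; monoidal
      _ = _ := by
        rw [← whisker_exchange]; monoidal

end PairingAction


/-! ### Coextension of morphisms along a coproduct -/

section Coextension

variable {D : Type u} [Category.{v} D] [MonoidalCategory D] {A B C X : D} [ComonObj C]

/-- The morphism `h ⊗ x ⊗ k ↦ f(h ⊗ x ⊗ k₁) ⊗ k₂`. -/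
def coextRight (f : A ⊗ (X ⊗ C) ⟶ X) : A ⊗ (X ⊗ C) ⟶ X ⊗ C :=
  A ◁ (X ◁ Δ[C] ≫ (α_ X C C).inv) ≫ (α_ A (X ⊗ C) C).inv ≫ f ▷ C

lemma coextRight_natural (f : A ⊗ (X ⊗ C) ⟶ X) (u : B ⟶ A) :
    u ▷ (X ⊗ C) ≫ coextRight f = coextRight (u ▷ (X ⊗ C) ≫ f) := by
  rw [coextRight, ← whisker_exchange_assoc, associator_inv_naturality_left_assoc,
    ← comp_whiskerRight, coextRight]

/-- The counit axiom makes `coextRight` injective, so an identity of coextended morphisms can be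
traded for an identity of the original ones. -/
lemma coextRight_counit (f : A ⊗ (X ⊗ C) ⟶ X) :
    coextRight f ≫ X ◁ ε[C] ≫ (ρ_ X).hom = f := by
  rw [coextRight, assoc, assoc, ← whisker_exchange_assoc, rightUnitor_naturality]
  calc
    _ = A ◁ (X ◁ (Δ[C] ≫ C ◁ ε[C] ≫ (ρ_ C).hom)) ≫ f := by monoidal
    _ = f := by simp

/-- The morphism `h ⊗ x ⊗ k ↦ h₁ ⊗ f(h₂ ⊗ x ⊗ k)`. -/
def coextLeft (f : C ⊗ (X ⊗ A) ⟶ X) : (C ⊗ X) ⊗ A ⟶ C ⊗ X :=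
  (Δ[C] ▷ X ≫ (α_ C C X).hom) ▷ A ≫ (α_ C (C ⊗ X) A).hom ≫ C ◁ ((α_ C X A).hom ≫ f)

lemma coextLeft_natural (f : C ⊗ (X ⊗ A) ⟶ X) (u : B ⟶ A) :
    (C ⊗ X) ◁ u ≫ coextLeft f = coextLeft (C ◁ X ◁ u ≫ f) := by
  rw [coextLeft, whisker_exchange_assoc, associator_naturality_right_assoc,
    ← MonoidalCategory.whiskerLeft_comp, associator_naturality_right_assoc, coextLeft]

lemma coextLeft_counit (f : C ⊗ (X ⊗ A) ⟶ X) :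
    coextLeft f ≫ ε[C] ▷ X ≫ (λ_ X).hom = (α_ C X A).hom ≫ f := by
  rw [coextLeft, assoc, assoc, whisker_exchange_assoc, leftUnitor_naturality]
  calc
    _ = ((Δ[C] ≫ ε[C] ▷ C ≫ (λ_ C).hom) ▷ X) ▷ A ≫ (α_ C X A).hom ≫ f := by monoidal
    _ = _ := by simp

end Coextension

/-! ### The two sides of the condition, with independent tensor factors -/

section YetterDrinfeldSides

variable {D : Type u} [Category.{v} D] [MonoidalCategory D] [BraidedCategory D]
  {U₁ U₂ V₁ V₂ S₁ S₂ T₁ T₂ X : D}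

/-- The morphism `h₁ ⊗ h₂ ⊗ x ⊗ k₁ ⊗ k₂ ↦ h₁ (x k₁) p(h₂, k₂)`. -/
def sideLeft (a : U₁ ⊗ X ⟶ X) (c : X ⊗ V₁ ⟶ X) (p : U₂ ⊗ V₂ ⟶ 𝟙_ D) :
    (U₁ ⊗ U₂) ⊗ (X ⊗ (V₁ ⊗ V₂)) ⟶ X :=
  (α_ U₁ U₂ (X ⊗ (V₁ ⊗ V₂))).hom ≫
    U₁ ◁ (U₂ ◁ ((α_ X V₁ V₂).inv ≫ c ▷ V₂) ≫
      (α_ U₂ X V₂).inv ≫ (β_ U₂ X).hom ▷ V₂ ≫ (α_ X U₂ V₂).hom ≫ X ◁ p ≫ (ρ_ X).hom) ≫ a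

/-- Naturality in the four factors separately allows a coproduct written as a sum of tensors to be
evaluated one summand at a time. -/
lemma sideLeft_natural (a : U₁ ⊗ X ⟶ X) (c : X ⊗ V₁ ⟶ X) (p : U₂ ⊗ V₂ ⟶ 𝟙_ D)
    (f₁ : S₁ ⟶ U₁) (f₂ : S₂ ⟶ U₂) (g₁ : T₁ ⟶ V₁) (g₂ : T₂ ⟶ V₂) :
    ((f₁ ⊗ₘ f₂) ⊗ₘ X ◁ (g₁ ⊗ₘ g₂)) ≫ sideLeft a c p =
      sideLeft (f₁ ▷ X ≫ a) (X ◁ g₁ ≫ c) ((f₂ ⊗ₘ g₂) ≫ p) := by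
  have h : (f₂ ⊗ₘ X ◁ (g₁ ⊗ₘ g₂)) ≫ U₂ ◁ ((α_ X V₁ V₂).inv ≫ c ▷ V₂) ≫
      (α_ U₂ X V₂).inv ≫ (β_ U₂ X).hom ▷ V₂ ≫ (α_ X U₂ V₂).hom ≫ X ◁ p ≫ (ρ_ X).hom =
      S₂ ◁ ((α_ X T₁ T₂).inv ≫ (X ◁ g₁ ≫ c) ▷ T₂) ≫
      (α_ S₂ X T₂).inv ≫ (β_ S₂ X).hom ▷ T₂ ≫ (α_ X S₂ T₂).hom ≫
        X ◁ ((f₂ ⊗ₘ g₂) ≫ p) ≫ (ρ_ X).hom := by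
    calc
      _ = 𝟙 _ ⊗≫ S₂ ◁ X ◁ g₁ ▷ T₂ ⊗≫ S₂ ◁ X ◁ V₁ ◁ g₂ ⊗≫
          (f₂ ▷ (X ⊗ V₁ ⊗ V₂) ≫ U₂ ◁ ((α_ X V₁ V₂).inv ≫ c ▷ V₂)) ⊗≫ (β_ U₂ X).hom ▷ V₂ ⊗≫
          X ◁ p ⊗≫ 𝟙 X := by
        rw [MonoidalCategory.tensorHom_def' f₂]
        simp only [MonoidalCategory.tensorHom_def]; monoidal
      _ = 𝟙 _ ⊗≫ S₂ ◁ X ◁ g₁ ▷ T₂ ⊗≫ S₂ ◁ ((X ⊗ V₁) ◁ g₂ ≫ c ▷ V₂) ⊗≫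
          (f₂ ▷ X ≫ (β_ U₂ X).hom) ▷ V₂ ⊗≫ X ◁ p ⊗≫ 𝟙 X := by
        rw [← whisker_exchange]; monoidal
      _ = 𝟙 _ ⊗≫ S₂ ◁ (X ◁ g₁ ≫ c) ▷ T₂ ⊗≫ ((S₂ ⊗ X) ◁ g₂ ≫ (β_ S₂ X).hom ▷ V₂) ⊗≫
          X ◁ (f₂ ▷ V₂ ≫ p) ⊗≫ 𝟙 X := by
        rw [whisker_exchange, braiding_naturality_left]; monoidal
      _ = _ := by
        rw [whisker_exchange]
        simp only [MonoidalCategory.tensorHom_def']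
        monoidal
  rw [sideLeft, associator_naturality_assoc, MonoidalCategory.tensorHom_def' f₁, assoc,
    ← whisker_exchange_assoc, ← MonoidalCategory.whiskerLeft_comp_assoc, h, sideLeft]

/-- The morphism `h₁ ⊗ h₂ ⊗ x ⊗ k₁ ⊗ k₂ ↦ p(h₁, k₁) (h₂ x) k₂`. -/
def sideRight (p : U₁ ⊗ V₁ ⟶ 𝟙_ D) (a : U₂ ⊗ X ⟶ X) (c : X ⊗ V₂ ⟶ X) :
    (U₁ ⊗ U₂) ⊗ (X ⊗ (V₁ ⊗ V₂)) ⟶ X :=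
  (α_ U₁ U₂ (X ⊗ (V₁ ⊗ V₂))).hom ≫
    U₁ ◁ ((α_ U₂ X (V₁ ⊗ V₂)).inv ≫ a ▷ (V₁ ⊗ V₂) ≫
        (α_ X V₁ V₂).inv ≫ (β_ X V₁).hom ▷ V₂ ≫ (α_ V₁ X V₂).hom) ≫
      (α_ U₁ V₁ (X ⊗ V₂)).inv ≫ p ▷ (X ⊗ V₂) ≫ (λ_ (X ⊗ V₂)).hom ≫ c

lemma sideRight_natural (p : U₁ ⊗ V₁ ⟶ 𝟙_ D) (a : U₂ ⊗ X ⟶ X) (c : X ⊗ V₂ ⟶ X)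
    (f₁ : S₁ ⟶ U₁) (f₂ : S₂ ⟶ U₂) (g₁ : T₁ ⟶ V₁) (g₂ : T₂ ⟶ V₂) :
    ((f₁ ⊗ₘ f₂) ⊗ₘ X ◁ (g₁ ⊗ₘ g₂)) ≫ sideRight p a c =
      sideRight ((f₁ ⊗ₘ g₁) ≫ p) (f₂ ▷ X ≫ a) (X ◁ g₂ ≫ c) := by
  have h : (f₂ ⊗ₘ X ◁ (g₁ ⊗ₘ g₂)) ≫ (α_ U₂ X (V₁ ⊗ V₂)).inv ≫ a ▷ (V₁ ⊗ V₂) ≫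
        (α_ X V₁ V₂).inv ≫ (β_ X V₁).hom ▷ V₂ ≫ (α_ V₁ X V₂).hom =
      ((α_ S₂ X (T₁ ⊗ T₂)).inv ≫ (f₂ ▷ X ≫ a) ▷ (T₁ ⊗ T₂) ≫
        (α_ X T₁ T₂).inv ≫ (β_ X T₁).hom ▷ T₂ ≫ (α_ T₁ X T₂).hom) ≫
        (g₁ ⊗ₘ (X ◁ g₂)) := by
    calc
      _ = 𝟙 _ ⊗≫ f₂ ▷ X ▷ (T₁ ⊗ T₂) ⊗≫ ((U₂ ⊗ X) ◁ (g₁ ⊗ₘ g₂) ≫ a ▷ (V₁ ⊗ V₂)) ⊗≫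
          (β_ X V₁).hom ▷ V₂ ⊗≫ 𝟙 _ := by
        simp only [MonoidalCategory.tensorHom_def]; monoidal
      _ = 𝟙 _ ⊗≫ (f₂ ▷ X ≫ a) ▷ (T₁ ⊗ T₂) ⊗≫ X ◁ g₁ ▷ T₂ ⊗≫
          ((X ⊗ V₁) ◁ g₂ ≫ (β_ X V₁).hom ▷ V₂) ⊗≫ 𝟙 _ := by
        rw [whisker_exchange]
        simp only [MonoidalCategory.tensorHom_def]; monoidal
      _ = 𝟙 _ ⊗≫ (f₂ ▷ X ≫ a) ▷ (T₁ ⊗ T₂) ⊗≫ (X ◁ g₁ ≫ (β_ X V₁).hom) ▷ T₂ ⊗≫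
          V₁ ◁ X ◁ g₂ := by
        rw [whisker_exchange]; monoidal
      _ = _ := by
        rw [braiding_naturality_right]
        simp only [MonoidalCategory.tensorHom_def]; monoidal
  rw [sideRight, associator_naturality_assoc, MonoidalCategory.tensorHom_def f₁, assoc,
    ← MonoidalCategory.whiskerLeft_comp_assoc, h, MonoidalCategory.whiskerLeft_comp_assoc,
    ← whisker_exchange_assoc, ← MonoidalCategory.tensorHom_def_assoc,
    associator_inv_naturality_assoc, MonoidalCategory.tensorHom_def (f₁ ⊗ₘ g₁), assoc,
    whisker_exchange_assoc, leftUnitor_naturality_assoc, ← comp_whiskerRight_assoc, sideRight]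

end YetterDrinfeldSides

/-! ### The Yetter-Drinfeld condition as linearity -/

section YetterDrinfeld

variable {D : Type u} [Category.{v} D] [MonoidalCategory D] [BraidedCategory D]
  {H₁ H₂ : D} [BimonObj H₁] [BimonObj H₂] (P : HopfPairing H₁ H₂) {X : D}
  (m₁ : LeftAction H₁ X) (m₂ : RightAction H₂ X)

/-- The morphism `h ⊗ x ⊗ k ↦ h₁ (x k₁) ρ(h₂, k₂)`. -/
def ydLeft : H₁ ⊗ (X ⊗ H₂) ⟶ X :=
  (Δ[H₁] ⊗ₘ X ◁ Δ[H₂]) ≫ sideLeft m₁.act m₂.act P.hom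

/-- The morphism `h ⊗ x ⊗ k ↦ ρ(h₁, k₁) (h₂ x) k₂`. -/
def ydRight : H₁ ⊗ (X ⊗ H₂) ⟶ X :=
  (Δ[H₁] ⊗ₘ X ◁ Δ[H₂]) ≫ sideRight P.hom m₁.act m₂.act

lemma isYetterDrinfeld_iff (m₁ : ModObj H₁ X) :
    IsYetterDrinfeld P m₁ m₂ ↔
      ydLeft P (LeftAction.ofModObj m₁) m₂ = ydRight P (LeftAction.ofModObj m₁) m₂ := Iff.rfl

/-- The morphism `X ⊗ H₂ ⟶ X ⊗ H₂`, `x ⊗ k ↦ x k₁ ⊗ k₂`. -/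
def shearRight : X ⊗ H₂ ⟶ X ⊗ H₂ := X ◁ Δ[H₂] ≫ (α_ X H₂ H₂).inv ≫ m₂.act ▷ H₂

/-- Both sides are h₁ (x k₁) ρ(h₂, k₂) ⊗ k₃; the only axiom needed is coassociativity of H₂, the
rest being sliding of strands. -/
lemma shearRight_tensor_act :
    H₁ ◁ shearRight m₂ ≫ (m₁.tensor P.leftAction).act = coextRight (ydLeft P m₁ m₂) := by
  calc
    _ = 𝟙 _ ⊗≫ H₁ ◁ X ◁ Δ[H₂] ⊗≫ (H₁ ◁ (m₂.act ▷ H₂) ≫ Δ[H₁] ▷ (X ⊗ H₂)) ⊗≫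
        H₁ ◁ (β_ H₁ X).hom ▷ H₂ ⊗≫
        (m₁.act ▷ (H₁ ⊗ H₂) ≫ X ◁ (H₁ ◁ Δ[H₂] ⊗≫ P.hom ▷ H₂ ⊗≫ 𝟙 H₂)) := by
      simp only [shearRight, LeftAction.tensor, HopfPairing.leftAction, tensorμ,
        MonoidalCategory.tensorHom_def]
      monoidal
    _ = 𝟙 _ ⊗≫ (H₁ ◁ X ◁ Δ[H₂] ≫ Δ[H₁] ▷ (X ⊗ (H₂ ⊗ H₂))) ⊗≫ H₁ ◁ H₁ ◁ (m₂.act ▷ H₂) ⊗≫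
        H₁ ◁ ((β_ H₁ X).hom ▷ H₂ ≫ (X ⊗ H₁) ◁ Δ[H₂]) ⊗≫ H₁ ◁ X ◁ P.hom ▷ H₂ ⊗≫
        m₁.act ▷ H₂ := by
      rw [whisker_exchange, ← whisker_exchange m₁.act]; monoidal
    _ = 𝟙 _ ⊗≫ Δ[H₁] ▷ (X ⊗ H₂) ⊗≫ H₁ ◁ H₁ ◁ X ◁ Δ[H₂] ⊗≫
        H₁ ◁ H₁ ◁ (m₂.act ▷ H₂ ≫ X ◁ Δ[H₂]) ⊗≫ H₁ ◁ (β_ H₁ X).hom ▷ (H₂ ⊗ H₂) ⊗≫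
        H₁ ◁ X ◁ P.hom ▷ H₂ ⊗≫ m₁.act ▷ H₂ := by
      rw [whisker_exchange, ← whisker_exchange (β_ H₁ X).hom]; monoidal
    _ = 𝟙 _ ⊗≫ Δ[H₁] ▷ (X ⊗ H₂) ⊗≫ H₁ ◁ H₁ ◁ X ◁ (Δ[H₂] ≫ H₂ ◁ Δ[H₂]) ⊗≫
        H₁ ◁ H₁ ◁ m₂.act ▷ (H₂ ⊗ H₂) ⊗≫ H₁ ◁ (β_ H₁ X).hom ▷ (H₂ ⊗ H₂) ⊗≫
        H₁ ◁ X ◁ P.hom ▷ H₂ ⊗≫ m₁.act ▷ H₂ := by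
      rw [← whisker_exchange m₂.act]; monoidal
    _ = 𝟙 _ ⊗≫ (Δ[H₁] ▷ (X ⊗ H₂) ≫ (H₁ ⊗ H₁) ◁ X ◁ Δ[H₂]) ⊗≫ H₁ ◁ H₁ ◁ X ◁ Δ[H₂] ▷ H₂ ⊗≫
        H₁ ◁ H₁ ◁ m₂.act ▷ (H₂ ⊗ H₂) ⊗≫ H₁ ◁ (β_ H₁ X).hom ▷ (H₂ ⊗ H₂) ⊗≫
        H₁ ◁ X ◁ P.hom ▷ H₂ ⊗≫ m₁.act ▷ H₂ := by
      have h : Δ[H₂] ≫ H₂ ◁ Δ[H₂] = Δ[H₂] ≫ Δ[H₂] ▷ H₂ ≫ (α_ _ _ _).hom := by simp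
      rw [h]; monoidal
    _ = _ := by
      rw [← whisker_exchange]
      simp only [coextRight, ydLeft, sideLeft, MonoidalCategory.tensorHom_def]
      monoidal

/-- Conjugating the action on H₂ ⊗ X by the braiding turns it into h ⊗ x ⊗ k ↦ ρ(h₁, k₁) (h₂ x) ⊗
k₂. -/
lemma tensor_act_braiding :
    H₁ ◁ (β_ X H₂).hom ≫ (P.leftAction.tensor m₁).act ≫ (β_ X H₂).inv =
      Δ[H₁] ▷ (X ⊗ H₂) ≫ (α_ H₁ H₁ (X ⊗ H₂)).hom ≫
        H₁ ◁ ((α_ H₁ X H₂).inv ≫ m₁.act ▷ H₂ ≫ X ◁ Δ[H₂] ≫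
          (α_ X H₂ H₂).inv ≫ (β_ X H₂).hom ▷ H₂ ≫ (α_ H₂ X H₂).hom) ≫
      (α_ H₁ H₂ (X ⊗ H₂)).inv ≫ P.hom ▷ (X ⊗ H₂) ≫ (λ_ (X ⊗ H₂)).hom := by
  rw [← assoc, Iso.comp_inv_eq]
  -- The action of H₁ on X slides through the braiding with H₂, the crossing with H₁ ⊗ X being split
  -- by the hexagon.
  have h1 : H₁ ◁ (β_ X H₂).hom ⊗≫ (β_ H₁ H₂).hom ▷ X ⊗≫ H₂ ◁ m₁.act =
      𝟙 _ ⊗≫ m₁.act ▷ H₂ ≫ (β_ X H₂).hom := by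
    rw [braiding_naturality_left, braiding_tensor_left_hom]; monoidal
  -- The coproduct of H₂ slides through the braiding with X.
  have h2 : X ◁ Δ[H₂] ⊗≫ (β_ X H₂).hom ▷ H₂ ⊗≫ H₂ ◁ (β_ X H₂).hom =
      ((β_ X H₂).hom ≫ Δ[H₂] ▷ X) ⊗≫ 𝟙 (H₂ ⊗ H₂ ⊗ X) := by
    rw [← braiding_naturality_right, braiding_tensor_right_hom]; monoidal
  calc
    _ = 𝟙 _ ⊗≫ (H₁ ◁ (β_ X H₂).hom ≫ Δ[H₁] ▷ (H₂ ⊗ X)) ⊗≫ H₁ ◁ (β_ H₁ H₂).hom ▷ X ⊗≫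
        H₁ ◁ H₂ ◁ m₁.act ⊗≫ (H₁ ◁ Δ[H₂] ⊗≫ P.hom ▷ H₂ ⊗≫ 𝟙 H₂) ▷ X := by
      simp only [LeftAction.tensor, HopfPairing.leftAction, tensorμ,
        MonoidalCategory.tensorHom_def']
      monoidal
    _ = 𝟙 _ ⊗≫ Δ[H₁] ▷ (X ⊗ H₂) ⊗≫
        H₁ ◁ (H₁ ◁ (β_ X H₂).hom ⊗≫ (β_ H₁ H₂).hom ▷ X ⊗≫ H₂ ◁ m₁.act) ⊗≫
        H₁ ◁ Δ[H₂] ▷ X ⊗≫ P.hom ▷ H₂ ▷ X ⊗≫ 𝟙 _ := by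
      rw [whisker_exchange]; monoidal
    _ = 𝟙 _ ⊗≫ Δ[H₁] ▷ (X ⊗ H₂) ⊗≫ H₁ ◁ m₁.act ▷ H₂ ⊗≫
        H₁ ◁ (((β_ X H₂).hom ≫ Δ[H₂] ▷ X) ⊗≫ 𝟙 (H₂ ⊗ H₂ ⊗ X)) ⊗≫ P.hom ▷ (H₂ ⊗ X) ⊗≫ 𝟙 _ := by
      rw [h1]; monoidal
    _ = 𝟙 _ ⊗≫ Δ[H₁] ▷ (X ⊗ H₂) ⊗≫ H₁ ◁ m₁.act ▷ H₂ ⊗≫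
        H₁ ◁ X ◁ Δ[H₂] ⊗≫ H₁ ◁ (β_ X H₂).hom ▷ H₂ ⊗≫
        ((H₁ ⊗ H₂) ◁ (β_ X H₂).hom ≫ P.hom ▷ (H₂ ⊗ X)) ⊗≫ 𝟙 _ := by
      rw [← h2]; monoidal
    _ = _ := by
      rw [whisker_exchange]; monoidal

/-- Both sides are ρ(h₁, k₁) (h₂ x) k₂ ⊗ k₃. Compared with `shearRight_tensor_act`, the same
morphism is applied after the action instead of before it. -/
lemma tensor_act_shearRight :
    H₁ ◁ (β_ X H₂).hom ≫ (P.leftAction.tensor m₁).act ≫ (β_ X H₂).inv ≫ shearRight m₂ =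
      coextRight (ydRight P m₁ m₂) := by
  have h := tensor_act_braiding P m₁
  rw [reassoc_of% h]
  calc
    _ = 𝟙 _ ⊗≫ Δ[H₁] ▷ (X ⊗ H₂) ⊗≫ H₁ ◁ (m₁.act ▷ H₂ ≫ X ◁ Δ[H₂]) ⊗≫
        H₁ ◁ (β_ X H₂).hom ▷ H₂ ⊗≫ (P.hom ▷ (X ⊗ H₂) ≫ (𝟙_ D) ◁ (X ◁ Δ[H₂])) ⊗≫
        m₂.act ▷ H₂ := by
      simp only [shearRight]; monoidal
    _ = 𝟙 _ ⊗≫ Δ[H₁] ▷ (X ⊗ H₂) ⊗≫ H₁ ◁ (H₁ ⊗ X) ◁ Δ[H₂] ⊗≫ H₁ ◁ m₁.act ▷ (H₂ ⊗ H₂) ⊗≫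
        H₁ ◁ ((β_ X H₂).hom ▷ H₂ ≫ (H₂ ⊗ X) ◁ Δ[H₂]) ⊗≫ P.hom ▷ (X ⊗ H₂ ⊗ H₂) ⊗≫
        m₂.act ▷ H₂ := by
      rw [← whisker_exchange, ← whisker_exchange]; monoidal
    _ = 𝟙 _ ⊗≫ Δ[H₁] ▷ (X ⊗ H₂) ⊗≫ H₁ ◁ (H₁ ⊗ X) ◁ Δ[H₂] ⊗≫
        H₁ ◁ (m₁.act ▷ (H₂ ⊗ H₂) ≫ X ◁ H₂ ◁ Δ[H₂]) ⊗≫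
        H₁ ◁ (β_ X H₂).hom ▷ (H₂ ⊗ H₂) ⊗≫ P.hom ▷ (X ⊗ H₂ ⊗ H₂) ⊗≫
        m₂.act ▷ H₂ := by
      rw [← whisker_exchange]; monoidal
    _ = 𝟙 _ ⊗≫ Δ[H₁] ▷ (X ⊗ H₂) ⊗≫ H₁ ◁ (H₁ ⊗ X) ◁ (Δ[H₂] ≫ H₂ ◁ Δ[H₂]) ⊗≫
        H₁ ◁ m₁.act ▷ (H₂ ⊗ H₂ ⊗ H₂) ⊗≫
        H₁ ◁ (β_ X H₂).hom ▷ (H₂ ⊗ H₂) ⊗≫ P.hom ▷ (X ⊗ H₂ ⊗ H₂) ⊗≫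
        m₂.act ▷ H₂ := by
      rw [← whisker_exchange]; monoidal
    _ = 𝟙 _ ⊗≫ (Δ[H₁] ▷ (X ⊗ H₂) ≫ (H₁ ⊗ H₁) ◁ (X ◁ Δ[H₂])) ⊗≫ H₁ ◁ (H₁ ⊗ X) ◁ Δ[H₂] ▷ H₂ ⊗≫
        H₁ ◁ m₁.act ▷ (H₂ ⊗ H₂ ⊗ H₂) ⊗≫
        H₁ ◁ (β_ X H₂).hom ▷ (H₂ ⊗ H₂) ⊗≫ P.hom ▷ (X ⊗ H₂ ⊗ H₂) ⊗≫
        m₂.act ▷ H₂ := by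
      have h : Δ[H₂] ≫ H₂ ◁ Δ[H₂] = Δ[H₂] ≫ Δ[H₂] ▷ H₂ ≫ (α_ _ _ _).hom := by simp
      rw [h]; monoidal
    _ = _ := by
      rw [← whisker_exchange]
      simp only [coextRight, ydRight, sideRight, MonoidalCategory.tensorHom_def]
      monoidal

/-- The morphism `H₁ ⊗ X ⟶ H₁ ⊗ X`, `h ⊗ x ↦ h₁ ⊗ h₂ x`. -/
def shearLeft : H₁ ⊗ X ⟶ H₁ ⊗ X := Δ[H₁] ▷ X ≫ (α_ H₁ H₁ X).hom ≫ H₁ ◁ m₁.act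

/-- Mirror image of `shearRight_tensor_act`: both sides are h₁ ⊗ ρ(h₂, k₁) (h₃ x) k₂, by
coassociativity of H₁. -/
lemma shearLeft_tensor_act :
    shearLeft m₁ ▷ H₂ ≫ (P.rightAction.tensor m₂).act = coextLeft (ydRight P m₁ m₂) := by
  calc
    _ = 𝟙 _ ⊗≫ Δ[H₁] ▷ X ▷ H₂ ⊗≫ ((H₁ ◁ m₁.act) ▷ H₂ ≫ (H₁ ⊗ X) ◁ Δ[H₂]) ⊗≫
        H₁ ◁ (β_ X H₂).hom ▷ H₂ ⊗≫
        ((H₁ ⊗ H₂) ◁ m₂.act ≫ (Δ[H₁] ▷ H₂ ⊗≫ H₁ ◁ P.hom ⊗≫ 𝟙 H₁) ▷ X) := by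
      simp only [shearLeft, RightAction.tensor, HopfPairing.rightAction, tensorμ,
        MonoidalCategory.tensorHom_def']
      monoidal
    _ = 𝟙 _ ⊗≫ (Δ[H₁] ▷ X ▷ H₂ ≫ ((H₁ ⊗ H₁) ⊗ X) ◁ Δ[H₂]) ⊗≫ H₁ ◁ m₁.act ▷ (H₂ ⊗ H₂) ⊗≫
        (H₁ ◁ ((β_ X H₂).hom ▷ H₂) ≫ Δ[H₁] ▷ ((H₂ ⊗ X) ⊗ H₂)) ⊗≫ H₁ ◁ P.hom ▷ (X ⊗ H₂) ⊗≫
        H₁ ◁ m₂.act := by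
      rw [← whisker_exchange, whisker_exchange _ m₂.act]; monoidal
    _ = 𝟙 _ ⊗≫ H₁ ◁ X ◁ Δ[H₂] ⊗≫ Δ[H₁] ▷ (X ⊗ (H₂ ⊗ H₂)) ⊗≫
        (H₁ ◁ (m₁.act ▷ (H₂ ⊗ H₂)) ≫ Δ[H₁] ▷ (X ⊗ (H₂ ⊗ H₂))) ⊗≫
        H₁ ◁ H₁ ◁ (β_ X H₂).hom ▷ H₂ ⊗≫ H₁ ◁ P.hom ▷ (X ⊗ H₂) ⊗≫
        H₁ ◁ m₂.act := by
      rw [whisker_exchange _ ((β_ X H₂).hom ▷ H₂), ← whisker_exchange]; monoidal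
    _ = 𝟙 _ ⊗≫ H₁ ◁ X ◁ Δ[H₂] ⊗≫ (Δ[H₁] ≫ Δ[H₁] ▷ H₁) ▷ (X ⊗ (H₂ ⊗ H₂)) ⊗≫
        H₁ ◁ H₁ ◁ (m₁.act ▷ (H₂ ⊗ H₂)) ⊗≫
        H₁ ◁ H₁ ◁ (β_ X H₂).hom ▷ H₂ ⊗≫ H₁ ◁ P.hom ▷ (X ⊗ H₂) ⊗≫
        H₁ ◁ m₂.act := by
      rw [whisker_exchange]; monoidal
    _ = 𝟙 _ ⊗≫ (H₁ ◁ X ◁ Δ[H₂] ≫ Δ[H₁] ▷ (X ⊗ (H₂ ⊗ H₂))) ⊗≫ H₁ ◁ Δ[H₁] ▷ (X ⊗ (H₂ ⊗ H₂)) ⊗≫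
        H₁ ◁ H₁ ◁ (m₁.act ▷ (H₂ ⊗ H₂)) ⊗≫
        H₁ ◁ H₁ ◁ (β_ X H₂).hom ▷ H₂ ⊗≫ H₁ ◁ P.hom ▷ (X ⊗ H₂) ⊗≫
        H₁ ◁ m₂.act := by
      rw [ComonObj.comul_assoc_flip]; monoidal
    _ = 𝟙 _ ⊗≫ Δ[H₁] ▷ (X ⊗ H₂) ⊗≫
        H₁ ◁ (H₁ ◁ X ◁ Δ[H₂] ≫ Δ[H₁] ▷ (X ⊗ (H₂ ⊗ H₂))) ⊗≫
        H₁ ◁ H₁ ◁ (m₁.act ▷ (H₂ ⊗ H₂)) ⊗≫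
        H₁ ◁ H₁ ◁ (β_ X H₂).hom ▷ H₂ ⊗≫ H₁ ◁ P.hom ▷ (X ⊗ H₂) ⊗≫
        H₁ ◁ m₂.act := by
      -- The same composite occurs inside the right-hand side, whiskered by H₁, and has to stay
      -- there unchanged.
      conv_lhs => rw [whisker_exchange]
      monoidal
    _ = _ := by
      rw [whisker_exchange]
      simp only [coextLeft, ydRight, sideRight, MonoidalCategory.tensorHom_def]
      monoidal

lemma braiding_tensor_act :
    (β_ H₁ X).hom ▷ H₂ ≫ (m₂.tensor P.rightAction).act ≫ (β_ H₁ X).inv =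
      (H₁ ⊗ X) ◁ Δ[H₂] ≫ (α_ (H₁ ⊗ X) H₂ H₂).inv ≫
        ((α_ H₁ X H₂).hom ≫ H₁ ◁ m₂.act ≫ Δ[H₁] ▷ X ≫
          (α_ H₁ H₁ X).hom ≫ H₁ ◁ (β_ H₁ X).hom ≫ (α_ H₁ X H₁).inv) ▷ H₂ ≫
      (α_ (H₁ ⊗ X) H₁ H₂).hom ≫ (H₁ ⊗ X) ◁ P.hom ≫ (ρ_ (H₁ ⊗ X)).hom := by
  rw [← assoc, Iso.comp_inv_eq]
  have h1 : (β_ H₁ X).hom ▷ H₂ ⊗≫ X ◁ (β_ H₁ H₂).hom ⊗≫ m₂.act ▷ H₁ =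
      𝟙 _ ⊗≫ H₁ ◁ m₂.act ≫ (β_ H₁ X).hom := by
    rw [braiding_naturality_right, braiding_tensor_right_hom]; monoidal
  have h2 : Δ[H₁] ▷ X ⊗≫ H₁ ◁ (β_ H₁ X).hom ⊗≫ (β_ H₁ X).hom ▷ H₁ =
      ((β_ H₁ X).hom ≫ X ◁ Δ[H₁]) ⊗≫ 𝟙 ((X ⊗ H₁) ⊗ H₁) := by
    rw [← braiding_naturality_left, braiding_tensor_left_hom]; monoidal
  calc
    _ = 𝟙 _ ⊗≫ ((β_ H₁ X).hom ▷ H₂ ≫ (X ⊗ H₁) ◁ Δ[H₂]) ⊗≫ X ◁ (β_ H₁ H₂).hom ▷ H₂ ⊗≫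
        m₂.act ▷ H₁ ▷ H₂ ⊗≫ X ◁ (Δ[H₁] ▷ H₂ ⊗≫ H₁ ◁ P.hom ⊗≫ 𝟙 H₁) := by
      simp only [RightAction.tensor, HopfPairing.rightAction, tensorμ,
        MonoidalCategory.tensorHom_def]
      monoidal
    _ = 𝟙 _ ⊗≫ (H₁ ⊗ X) ◁ Δ[H₂] ⊗≫
        ((β_ H₁ X).hom ▷ H₂ ⊗≫ X ◁ (β_ H₁ H₂).hom ⊗≫ m₂.act ▷ H₁) ▷ H₂ ⊗≫
        X ◁ Δ[H₁] ▷ H₂ ⊗≫ X ◁ H₁ ◁ P.hom ⊗≫ 𝟙 _ := by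
      rw [← whisker_exchange]; monoidal
    _ = 𝟙 _ ⊗≫ (H₁ ⊗ X) ◁ Δ[H₂] ⊗≫ H₁ ◁ m₂.act ▷ H₂ ⊗≫
        (((β_ H₁ X).hom ≫ X ◁ Δ[H₁]) ⊗≫ 𝟙 ((X ⊗ H₁) ⊗ H₁)) ▷ H₂ ⊗≫ (X ⊗ H₁) ◁ P.hom ⊗≫ 𝟙 _ := by
      rw [h1]; monoidal
    _ = 𝟙 _ ⊗≫ (H₁ ⊗ X) ◁ Δ[H₂] ⊗≫ H₁ ◁ m₂.act ▷ H₂ ⊗≫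
        Δ[H₁] ▷ X ▷ H₂ ⊗≫ H₁ ◁ (β_ H₁ X).hom ▷ H₂ ⊗≫
        ((β_ H₁ X).hom ▷ (H₁ ⊗ H₂) ≫ (X ⊗ H₁) ◁ P.hom) ⊗≫ 𝟙 _ := by
      rw [← h2]; monoidal
    _ = _ := by
      rw [← whisker_exchange]; monoidal

/-- Both sides are h₁ ⊗ h₂ (x k₁) ρ(h₃, k₂), the counterpart of `shearLeft_tensor_act` with the
other side of the condition. -/
lemma tensor_act_shearLeft :
    (β_ H₁ X).hom ▷ H₂ ≫ (m₂.tensor P.rightAction).act ≫ (β_ H₁ X).inv ≫ shearLeft m₁ =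
      coextLeft (ydLeft P m₁ m₂) := by
  have h := braiding_tensor_act P m₂
  rw [reassoc_of% h]
  calc
    _ = 𝟙 _ ⊗≫ (H₁ ⊗ X) ◁ Δ[H₂] ⊗≫ (H₁ ◁ m₂.act ≫ Δ[H₁] ▷ X) ▷ H₂ ⊗≫
        H₁ ◁ (β_ H₁ X).hom ▷ H₂ ⊗≫ ((H₁ ⊗ X) ◁ P.hom ≫ (Δ[H₁] ▷ X) ▷ (𝟙_ D)) ⊗≫
        H₁ ◁ m₁.act := by
      simp only [shearLeft]; monoidal
    _ = 𝟙 _ ⊗≫ (H₁ ⊗ X) ◁ Δ[H₂] ⊗≫ Δ[H₁] ▷ ((X ⊗ H₂) ⊗ H₂) ⊗≫ H₁ ◁ H₁ ◁ m₂.act ▷ H₂ ⊗≫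
        (H₁ ◁ (β_ H₁ X).hom ≫ Δ[H₁] ▷ (X ⊗ H₁)) ▷ H₂ ⊗≫ H₁ ◁ H₁ ◁ X ◁ P.hom ⊗≫
        H₁ ◁ m₁.act := by
      rw [whisker_exchange, whisker_exchange]; monoidal
    _ = 𝟙 _ ⊗≫ (H₁ ⊗ X) ◁ Δ[H₂] ⊗≫ Δ[H₁] ▷ ((X ⊗ H₂) ⊗ H₂) ⊗≫
        (H₁ ◁ (H₁ ◁ m₂.act) ≫ Δ[H₁] ▷ (H₁ ⊗ X)) ▷ H₂ ⊗≫
        H₁ ◁ H₁ ◁ (β_ H₁ X).hom ▷ H₂ ⊗≫ H₁ ◁ H₁ ◁ X ◁ P.hom ⊗≫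
        H₁ ◁ m₁.act := by
      rw [whisker_exchange]; monoidal
    _ = 𝟙 _ ⊗≫ (H₁ ⊗ X) ◁ Δ[H₂] ⊗≫ (Δ[H₁] ≫ Δ[H₁] ▷ H₁) ▷ ((X ⊗ H₂) ⊗ H₂) ⊗≫
        H₁ ◁ H₁ ◁ H₁ ◁ m₂.act ▷ H₂ ⊗≫
        H₁ ◁ H₁ ◁ (β_ H₁ X).hom ▷ H₂ ⊗≫ H₁ ◁ H₁ ◁ X ◁ P.hom ⊗≫
        H₁ ◁ m₁.act := by
      rw [whisker_exchange]; monoidal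
    _ = 𝟙 _ ⊗≫ (H₁ ◁ (X ◁ Δ[H₂]) ≫ Δ[H₁] ▷ (X ⊗ (H₂ ⊗ H₂))) ⊗≫ H₁ ◁ Δ[H₁] ▷ ((X ⊗ H₂) ⊗ H₂) ⊗≫
        H₁ ◁ H₁ ◁ H₁ ◁ m₂.act ▷ H₂ ⊗≫
        H₁ ◁ H₁ ◁ (β_ H₁ X).hom ▷ H₂ ⊗≫ H₁ ◁ H₁ ◁ X ◁ P.hom ⊗≫
        H₁ ◁ m₁.act := by
      rw [ComonObj.comul_assoc_flip]; monoidal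
    _ = 𝟙 _ ⊗≫ Δ[H₁] ▷ (X ⊗ H₂) ⊗≫
        H₁ ◁ (H₁ ◁ (X ◁ Δ[H₂]) ≫ Δ[H₁] ▷ (X ⊗ (H₂ ⊗ H₂))) ⊗≫
        H₁ ◁ H₁ ◁ H₁ ◁ m₂.act ▷ H₂ ⊗≫
        H₁ ◁ H₁ ◁ (β_ H₁ X).hom ▷ H₂ ⊗≫ H₁ ◁ H₁ ◁ X ◁ P.hom ⊗≫
        H₁ ◁ m₁.act := by
      conv_lhs => rw [whisker_exchange]
      monoidal
    _ = _ := by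
      rw [whisker_exchange]
      simp only [coextLeft, ydLeft, sideLeft, MonoidalCategory.tensorHom_def]
      monoidal

end YetterDrinfeld


/-! ### Evaluation of the sides on units -/

section SideUnits

variable {D : Type u} [Category.{v} D] [MonoidalCategory D] [BraidedCategory D] {U V X : D}

lemma sideLeft_unit_left (p : U ⊗ V ⟶ 𝟙_ D) :
    ((λ_ U).inv ⊗ₘ X ◁ (λ_ V).inv) ≫ sideLeft (λ_ X).hom (ρ_ X).hom p =
      (α_ U X V).inv ≫ (β_ U X).hom ▷ V ≫ (α_ X U V).hom ≫ X ◁ p ≫ (ρ_ X).hom := by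
  simp only [sideLeft, MonoidalCategory.tensorHom_def]
  monoidal

lemma sideLeft_unit_right (a : U ⊗ X ⟶ X) (c : X ⊗ V ⟶ X) :
    ((ρ_ U).inv ⊗ₘ X ◁ (ρ_ V).inv) ≫ sideLeft a c (λ_ (𝟙_ D)).hom = U ◁ c ≫ a := by
  simp only [sideLeft, MonoidalCategory.tensorHom_def, braiding_tensorUnit_left]
  monoidal

lemma sideRight_unit_left (a : U ⊗ X ⟶ X) (c : X ⊗ V ⟶ X) :
    ((λ_ U).inv ⊗ₘ X ◁ (λ_ V).inv) ≫ sideRight (λ_ (𝟙_ D)).hom a c =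
      (α_ U X V).inv ≫ a ▷ V ≫ c := by
  simp only [sideRight, MonoidalCategory.tensorHom_def, braiding_tensorUnit_right]
  monoidal

lemma sideRight_unit_right (p : U ⊗ V ⟶ 𝟙_ D) :
    ((ρ_ U).inv ⊗ₘ X ◁ (ρ_ V).inv) ≫ sideRight p (λ_ X).hom (ρ_ X).hom =
      U ◁ (β_ X V).hom ≫ (α_ U V X).inv ≫ p ▷ X ≫ (λ_ X).hom := by
  simp only [sideRight, MonoidalCategory.tensorHom_def]
  monoidal

variable {H₁ H₂ : D} [BimonObj H₁] [BimonObj H₂] (P : HopfPairing H₁ H₂)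
  (m₁ : LeftAction H₁ X) (m₂ : RightAction H₂ X)

lemma whiskerLeft_one_comul (W : D) : W ◁ X ◁ η[H₂] ≫ W ◁ X ◁ Δ[H₂] =
    W ◁ X ◁ (λ_ (𝟙_ D)).inv ≫ W ◁ X ◁ (η[H₂] ⊗ₘ η[H₂]) := by
  simp only [← MonoidalCategory.whiskerLeft_comp]
  rw [BimonObj.one_comul, MonObj.tensorObj.one_def]

/-- Since ρ(h₂, 1) = ε(h₂), the coproduct of h collapses to h x. With `one_ydRight`, the condition
at k = 1 holds for any pair of actions. -/
lemma one_ydLeft : H₁ ◁ X ◁ η[H₂] ≫ ydLeft P m₁ m₂ = H₁ ◁ (ρ_ X).hom ≫ m₁.act := by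
  -- This form presents the counit as a morphism on the second tensor factor, so that
  -- `sideLeft_natural` can move it next to the coproduct.
  have hp : (𝟙 H₁ ⊗ₘ η[H₂]) ≫ P.hom = (ε[H₁] ⊗ₘ 𝟙 (𝟙_ D)) ≫ (λ_ (𝟙_ D)).hom := by
    rw [id_tensorHom, P.one_right, tensorHom_id, unitors_equal, rightUnitor_naturality]
  have h1 := sideLeft_natural m₁.act m₂.act P.hom (𝟙 H₁) (𝟙 H₁) η[H₂] η[H₂]
  have h2 := sideLeft_natural m₁.act (ρ_ X).hom (λ_ (𝟙_ D)).hom (𝟙 H₁) ε[H₁] (𝟙 _) (𝟙 _)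
  rw [hp, m₂.act_one, id_whiskerRight, id_comp, id_tensorHom_id, id_tensorHom] at h1
  rw [id_whiskerRight, id_comp, whiskerLeft_id, id_comp, id_tensorHom_id, id_tensorHom,
    whiskerLeft_id, tensorHom_id] at h2
  rw [ydLeft, MonoidalCategory.tensorHom_def', ← assoc, ← assoc, whiskerLeft_one_comul, assoc,
    assoc, whisker_exchange_assoc, h1, ← h2, ← comp_whiskerRight_assoc, ComonObj.comul_counit,
    unitors_inv_equal, ← MonoidalCategory.tensorHom_def'_assoc, sideLeft_unit_right]

lemma one_ydRight : H₁ ◁ X ◁ η[H₂] ≫ ydRight P m₁ m₂ = H₁ ◁ (ρ_ X).hom ≫ m₁.act := by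
  have hp : (𝟙 H₁ ⊗ₘ η[H₂]) ≫ P.hom = (ε[H₁] ⊗ₘ 𝟙 (𝟙_ D)) ≫ (λ_ (𝟙_ D)).hom := by
    rw [id_tensorHom, P.one_right, tensorHom_id, unitors_equal, rightUnitor_naturality]
  have h1 := sideRight_natural P.hom m₁.act m₂.act (𝟙 H₁) (𝟙 H₁) η[H₂] η[H₂]
  have h2 := sideRight_natural (λ_ (𝟙_ D)).hom m₁.act (ρ_ X).hom ε[H₁] (𝟙 H₁) (𝟙 _) (𝟙 _)
  rw [hp, m₂.act_one, id_whiskerRight, id_comp, id_tensorHom_id, id_tensorHom] at h1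
  rw [id_whiskerRight, id_comp, whiskerLeft_id, id_comp, id_tensorHom_id, tensorHom_id,
    whiskerLeft_id, tensorHom_id] at h2
  rw [ydRight, MonoidalCategory.tensorHom_def', ← assoc, ← assoc, whiskerLeft_one_comul, assoc,
    assoc, whisker_exchange_assoc, h1, ← h2, ← comp_whiskerRight_assoc, ComonObj.counit_comul,
    ← MonoidalCategory.tensorHom_def'_assoc, sideRight_unit_left]
  simp

end SideUnits

/-! ### Linearity over a tensor algebra tested on generators -/

namespace TensorAlg

variable {D : Type u} [Category.{v} D] [MonoidalCategory D] [HasCoproductsOfShape ℕ D]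
  [∀ Y : D, PreservesColimitsOfShape (Discrete ℕ) (tensorLeft Y)]
  [∀ Y : D, PreservesColimitsOfShape (Discrete ℕ) (tensorRight Y)] {F G : D}

section Linear

variable {M N W : D}

lemma succ_act (a : LeftAction (TensorAlg F) M) :
    succ F ▷ M ≫ a.act = (α_ _ _ _).hom ≫ TensorAlg F ◁ (gen F ▷ M ≫ a.act) ≫ a.act := by
  have h : mul F ▷ M ≫ a.act = (α_ _ _ _).hom ≫ TensorAlg F ◁ a.act ≫ a.act := a.mul_act
  rw [← mul_gen, comp_whiskerRight_assoc, h]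
  simp

lemma act_succ (a : RightAction (TensorAlg F) M) (n : ℕ) :
    M ◁ (incl F n ▷ F ≫ succ F) ≫ a.act =
      (α_ _ _ _).inv ≫ (M ◁ incl F n ≫ a.act) ▷ F ≫ M ◁ gen F ≫ a.act := by
  have h : M ◁ mul F ≫ a.act = (α_ _ _ _).inv ≫ a.act ▷ TensorAlg F ≫ a.act := a.act_mul
  rw [← mul_gen, MonoidalCategory.whiskerLeft_comp_assoc, MonoidalCategory.whiskerLeft_comp_assoc,
    h, associator_inv_naturality_right_assoc, whisker_exchange_assoc,
    associator_inv_naturality_middle_assoc, comp_whiskerRight_assoc]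

/-- A morphism commuting with the action of the generators commutes with the right action of the
tensor algebra. -/
lemma rightLinear_of_gen (a : RightAction (TensorAlg F) M) (a' : RightAction (TensorAlg F) N)
    (t : M ⟶ N) (h : M ◁ gen F ≫ a.act ≫ t = M ◁ gen F ≫ t ▷ TensorAlg F ≫ a'.act) :
    a.act ≫ t = t ▷ TensorAlg F ≫ a'.act := by
  have h1 {Q : D} (b : RightAction (TensorAlg F) Q) : Q ◁ unit F ≫ b.act = (ρ_ Q).hom := b.act_one
  apply ext_ind_left
  · rw [reassoc_of% (h1 a), whisker_exchange_assoc, h1, rightUnitor_naturality]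
  · intro n ih
    -- In a right action the last letter of a word acts last: `ih` handles the first n letters and
    -- `h` the remaining generator.
    have e := act_succ a n
    rw [reassoc_of% e, h, whisker_exchange_assoc, whisker_exchange_assoc, act_succ,
      associator_inv_naturality_left_assoc, ← comp_whiskerRight_assoc, ← comp_whiskerRight_assoc,
      assoc, ih, whisker_exchange_assoc]

variable [Preadditive D] [MonoidalPreadditive D]

/-- Inductive criterion for a morphism to commute with the left action of the tensor algebra on the
image of `w`. -/
lemma leftLinear_of_gen (a : LeftAction (TensorAlg F) M) (a' : LeftAction (TensorAlg F) N)
    (t : M ⟶ N) (w : W ⟶ M) (p : F ⊗ W ⟶ M) (q : F ⊗ W ⟶ W)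
    (hpq : F ◁ w ≫ gen F ▷ M ≫ a.act = p + q ≫ w)
    (hp : TensorAlg F ◁ p ≫ a.act ≫ t = TensorAlg F ◁ p ≫ TensorAlg F ◁ t ≫ a'.act)
    (hw : F ◁ w ≫ gen F ▷ M ≫ a.act ≫ t = F ◁ w ≫ gen F ▷ M ≫ TensorAlg F ◁ t ≫ a'.act) :
    TensorAlg F ◁ w ≫ a.act ≫ t = TensorAlg F ◁ w ≫ TensorAlg F ◁ t ≫ a'.act := by
  have h1 {Q : D} (b : LeftAction (TensorAlg F) Q) : unit F ▷ Q ≫ b.act = (λ_ Q).hom := b.one_act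
  apply ext_ind_right
  · rw [← whisker_exchange_assoc, ← whisker_exchange_assoc, reassoc_of% (h1 a),
      ← whisker_exchange_assoc, h1, leftUnitor_naturality]
  · intro n ih
    -- In a left action the last letter of a word acts first, so the generator meets the image of
    -- `w` before the other n letters do.
    have e {Q V : D} (b : LeftAction (TensorAlg F) Q) (x : V ⟶ Q) :
        (incl F n ▷ F ≫ succ F) ▷ V ≫ TensorAlg F ◁ x ≫ b.act =
          (α_ _ _ _).hom ≫ tpow F n ◁ (F ◁ x ≫ gen F ▷ Q ≫ b.act) ≫ incl F n ▷ Q ≫ b.act := by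
      rw [← whisker_exchange_assoc, comp_whiskerRight_assoc, succ_act,
        associator_naturality_left_assoc, ← whisker_exchange_assoc,
        associator_naturality_right_assoc]
      simp only [MonoidalCategory.whiskerLeft_comp, assoc]
    have e1 := e a w
    have e2 := e a' (w ≫ t)
    -- Linearity for one generator carries the decomposition `hpq` over to the target. On the `p`
    -- part the remaining n letters are handled by `hp`, on the `q` part, which lies again in the
    -- image of `w`, by `ih`.
    have hw' : F ◁ (w ≫ t) ≫ gen F ▷ N ≫ a'.act = p ≫ t + q ≫ w ≫ t := by
      rw [MonoidalCategory.whiskerLeft_comp_assoc, whisker_exchange_assoc, ← hw, ← assoc, ← assoc,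
        assoc (F ◁ w), hpq, Preadditive.add_comp, assoc]
    rw [reassoc_of% e1, ← MonoidalCategory.whiskerLeft_comp_assoc, e2, hpq, hw', cancel_epi]
    simp only [MonoidalPreadditive.whiskerLeft_add, Preadditive.add_comp,
      MonoidalCategory.whiskerLeft_comp, assoc]
    have hp' := incl F n ▷ _ ≫= hp
    have ih' := tpow F n ◁ q ≫= ih
    simp only [← whisker_exchange_assoc] at hp' ih'
    rw [hp', ih']

end Linear
end TensorAlg


/-! ### Linearity of the Yetter-Drinfeld braiding on restricted arguments -/

section Restriction

variable {D : Type u} [Category.{v} D] [MonoidalCategory D] [BraidedCategory D]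
  {H₁ H₂ A K X : D} [BimonObj H₁] [BimonObj H₂] (P : HopfPairing H₁ H₂)
  (m₁ : LeftAction H₁ X) (m₂ : RightAction H₂ X)

/-- The Yetter-Drinfeld braiding `H₂ ⊗ X ⟶ X ⊗ H₂`, `k ⊗ x ↦ x k₁ ⊗ k₂`. -/
def ydBraiding : H₂ ⊗ X ⟶ X ⊗ H₂ := (β_ X H₂).inv ≫ shearRight m₂

/-- With `restrict_act_ydBraiding` this expresses both composites in the linearity of `ydBraiding`
on chosen arguments through `ydLeft` and `ydRight` on those arguments. The common inverse braiding
can be cancelled. -/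
lemma restrict_ydBraiding_act (u : A ⟶ H₁) (k : K ⟶ H₂) :
    A ◁ k ▷ X ≫ u ▷ _ ≫ H₁ ◁ ydBraiding m₂ ≫ (m₁.tensor P.leftAction).act =
      A ◁ (β_ X K).inv ≫ A ◁ X ◁ k ≫ coextRight (u ▷ _ ≫ ydLeft P m₁ m₂) := by
  rw [ydBraiding, MonoidalCategory.whiskerLeft_comp_assoc, shearRight_tensor_act,
    ← whisker_exchange_assoc, coextRight_natural, ← MonoidalCategory.whiskerLeft_comp_assoc,
    braiding_inv_naturality_left, MonoidalCategory.whiskerLeft_comp_assoc]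

lemma restrict_act_ydBraiding (u : A ⟶ H₁) (k : K ⟶ H₂) :
    A ◁ k ▷ X ≫ u ▷ _ ≫ (P.leftAction.tensor m₁).act ≫ ydBraiding m₂ =
      A ◁ (β_ X K).inv ≫ A ◁ X ◁ k ≫ coextRight (u ▷ _ ≫ ydRight P m₁ m₂) := by
  rw [← coextRight_natural, ← tensor_act_shearRight, ← whisker_exchange_assoc,
    ← MonoidalCategory.whiskerLeft_comp_assoc, ← MonoidalCategory.whiskerLeft_comp_assoc,
    ← braiding_inv_naturality_left, assoc,
    Iso.inv_hom_id, comp_id]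
  rfl

end Restriction

section CoextTensor

variable {D : Type u} [Category.{v} D] [MonoidalCategory D] {A C X V W : D}

lemma tensor_coextRight (f : A ⊗ (X ⊗ C) ⟶ X) (v : V ⟶ C) (w : W ⟶ C) :
    A ◁ X ◁ (v ⊗ₘ w) ≫ A ◁ (α_ X C C).inv ≫ (α_ A (X ⊗ C) C).inv ≫ f ▷ C =
      A ◁ (α_ X V W).inv ≫ (α_ A (X ⊗ V) W).inv ≫ (A ◁ X ◁ v ≫ f) ▷ W ≫ X ◁ w := by
  calc
    _ = 𝟙 _ ⊗≫ A ◁ X ◁ v ▷ W ⊗≫ ((A ⊗ X ⊗ C) ◁ w ≫ f ▷ C) := by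
      rw [MonoidalCategory.tensorHom_def]; monoidal
    _ = _ := by
      rw [whisker_exchange]; monoidal

end CoextTensor

/-! ### Reduction of the Yetter-Drinfeld condition to generators -/

namespace TensorAlg

variable {D : Type u} [Category.{v} D] [MonoidalCategory D] [HasCoproductsOfShape ℕ D]
  [∀ Y : D, PreservesColimitsOfShape (Discrete ℕ) (tensorLeft Y)]
  [∀ Y : D, PreservesColimitsOfShape (Discrete ℕ) (tensorRight Y)]
  [Preadditive D] [MonoidalPreadditive D] [BraidedCategory D] {F G X : D}

/-- The unit is group-like, so the coextension at 1 only involves `f` at 1. -/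
lemma unit_coextRight_congr {A : D} {f g : A ⊗ (X ⊗ TensorAlg G) ⟶ X}
    (h : A ◁ X ◁ unit G ≫ f = A ◁ X ◁ unit G ≫ g) :
    A ◁ X ◁ unit G ≫ coextRight f = A ◁ X ◁ unit G ≫ coextRight g := by
  have e (f : A ⊗ (X ⊗ TensorAlg G) ⟶ X) : A ◁ X ◁ unit G ≫ coextRight f =
      A ◁ X ◁ (unit G ≫ comul G) ≫ A ◁ (α_ _ _ _).inv ≫ (α_ _ _ _).inv ≫ f ▷ _ := by
    simp only [MonoidalCategory.whiskerLeft_comp, assoc]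
    simp only [coextRight, MonoidalCategory.whiskerLeft_comp, assoc]
    rfl
  rw [e, e, unit_comul]
  simp only [MonoidalCategory.whiskerLeft_comp, assoc]
  rw [tensor_coextRight, tensor_coextRight, h]

/-- Generators are primitive, so the coextension at g involves `f` at 1 and at g; hence the two
hypotheses. -/
lemma gen_coextRight_congr {A : D} {f g : A ⊗ (X ⊗ TensorAlg G) ⟶ X}
    (h : A ◁ X ◁ unit G ≫ f = A ◁ X ◁ unit G ≫ g)
    (h' : A ◁ X ◁ gen G ≫ f = A ◁ X ◁ gen G ≫ g) :
    A ◁ X ◁ gen G ≫ coextRight f = A ◁ X ◁ gen G ≫ coextRight g := by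
  have e (f : A ⊗ (X ⊗ TensorAlg G) ⟶ X) : A ◁ X ◁ gen G ≫ coextRight f =
      A ◁ X ◁ (gen G ≫ comul G) ≫ A ◁ (α_ _ _ _).inv ≫ (α_ _ _ _).inv ≫ f ▷ _ := by
    simp only [MonoidalCategory.whiskerLeft_comp, assoc]
    simp only [coextRight, MonoidalCategory.whiskerLeft_comp, assoc]
    rfl
  rw [e, e, gen_comul]
  simp only [MonoidalPreadditive.whiskerLeft_add, Preadditive.add_comp,
    MonoidalCategory.whiskerLeft_comp, assoc]
  simp only [tensor_coextRight, h, h']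

variable (b : F ⊗ G ⟶ 𝟙_ D)

lemma unit_unit_extPairing :
    (unit F ⊗ₘ unit G) ≫ (extPairing b).hom = (λ_ (𝟙_ D)).hom := by
  have h : unit F ▷ TensorAlg G ≫ (extPairing b).hom = _ := unit_ext b
  rw [MonoidalCategory.tensorHom_def', assoc, h, leftUnitor_naturality_assoc, unit_counit, comp_id]

lemma unit_gen_extPairing : (unit F ⊗ₘ gen G) ≫ (extPairing b).hom = 0 := by
  have h : unit F ▷ TensorAlg G ≫ (extPairing b).hom = _ := unit_ext b
  rw [MonoidalCategory.tensorHom_def', assoc, h, leftUnitor_naturality_assoc, gen_counit, comp_zero]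

lemma gen_unit_extPairing : (gen F ⊗ₘ unit G) ≫ (extPairing b).hom = 0 := by
  have h : TensorAlg F ◁ unit G ≫ (extPairing b).hom = _ := ext_unit b
  rw [MonoidalCategory.tensorHom_def, assoc, h, rightUnitor_naturality_assoc, gen_counit, comp_zero]

/-- From Δ(g) = 1 ⊗ g + g ⊗ 1 one gets f·g = ρ(f, 1) g + ρ(f, g) 1, and ρ(f, 1) = ε(f) = 0. -/
lemma gen_gen_leftAction :
    (gen F ⊗ₘ gen G) ≫ (extPairing b).leftAction.act = b ≫ unit G := by
  have h : TensorAlg F ◁ gen G ≫ (extPairing b).leftAction.act =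
      TensorAlg F ◁ (gen G ≫ comul G) ≫ (α_ _ _ _).inv ≫ (extPairing b).hom ▷ _ ≫ (λ_ _).hom := by
    rw [MonoidalCategory.whiskerLeft_comp_assoc]; rfl
  have e {V W : D} (v : V ⟶ TensorAlg G) (w : W ⟶ TensorAlg G) :
      gen F ▷ (V ⊗ W) ≫ TensorAlg F ◁ (v ⊗ₘ w) ≫ (α_ _ _ _).inv ≫ (extPairing b).hom ▷ _ ≫
        (λ_ _).hom = (α_ _ _ _).inv ≫ ((gen F ⊗ₘ v) ≫ (extPairing b).hom) ▷ W ≫ (λ_ _).hom ≫ w := by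
    rw [← MonoidalCategory.tensorHom_def_assoc, associator_inv_naturality_assoc,
      MonoidalCategory.tensorHom_def _ w, assoc, whisker_exchange_assoc, leftUnitor_naturality,
      comp_whiskerRight_assoc]
  rw [MonoidalCategory.tensorHom_def, assoc, h, gen_comul]
  simp only [MonoidalPreadditive.whiskerLeft_add, Preadditive.add_comp, Preadditive.comp_add,
    MonoidalCategory.whiskerLeft_comp, assoc]
  rw [← whisker_exchange_assoc (gen F) (λ_ G).inv, ← whisker_exchange_assoc (gen F) (ρ_ G).inv, e,
    e, gen_unit_extPairing,
    gen_gen_extPairing]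
  simp [unitors_equal]

variable (m₁ : LeftAction (TensorAlg F) X) (m₂ : RightAction (TensorAlg G) X)

/-- A primitive f acts on g ⊗ x by a Leibniz rule: f·g = b(f, g) 1 gives a term through the unit,
and f x gives a term that stays in G ⊗ X. These are the `p` and `q` of `leftLinear_of_gen`. -/
lemma gen_tensor_act : F ◁ gen G ▷ X ≫ gen F ▷ (TensorAlg G ⊗ X) ≫
      ((extPairing b).leftAction.tensor m₁).act =
    ((ρ_ F).inv ▷ (G ⊗ X) ≫ tensorμ F (𝟙_ D) G X ≫ (b ⊗ₘ (λ_ X).hom)) ≫ unit G ▷ X +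
    ((λ_ F).inv ▷ (G ⊗ X) ≫ tensorμ (𝟙_ D) F G X ≫ ((λ_ G).hom ⊗ₘ gen F ▷ X ≫ m₁.act)) ≫
      gen G ▷ X := by
  have h1 {Q : D} (b : LeftAction (TensorAlg F) Q) : unit F ▷ Q ≫ b.act = (λ_ Q).hom := b.one_act
  have e {V W : D} (v : V ⟶ TensorAlg F) (w : W ⟶ TensorAlg F) :
      (V ⊗ W) ◁ gen G ▷ X ≫ (v ⊗ₘ w) ▷ _ ≫ tensorμ _ _ _ _ ≫
        ((extPairing b).leftAction.act ⊗ₘ m₁.act) =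
      tensorμ V W G X ≫ ((v ⊗ₘ gen G) ≫ (extPairing b).leftAction.act ⊗ₘ w ▷ X ≫ m₁.act) := by
    have := tensorμ_natural v w (gen G) (𝟙 X)
    rw [tensorHom_id, tensorHom_id, MonoidalCategory.tensorHom_def', assoc] at this
    rw [reassoc_of% this, tensorHom_comp_tensorHom]
  have h : gen F ▷ (TensorAlg G ⊗ X) ≫ ((extPairing b).leftAction.tensor m₁).act =
      (gen F ≫ comul F) ▷ _ ≫ tensorμ _ _ _ _ ≫
        ((extPairing b).leftAction.act ⊗ₘ m₁.act) := by
    rw [comp_whiskerRight_assoc]; rfl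
  rw [h, gen_comul]
  simp only [MonoidalPreadditive.add_whiskerRight, Preadditive.add_comp, Preadditive.comp_add,
    comp_whiskerRight, assoc]
  rw [whisker_exchange_assoc (λ_ F).inv, whisker_exchange_assoc (ρ_ F).inv, e, e, gen_gen_leftAction, h1,
    MonoidalCategory.tensorHom_def' (unit F), assoc, h1, leftUnitor_naturality, add_comm]
  simp only [tensorHom_comp_whiskerRight]

/-- The Yetter-Drinfeld condition on generators of both tensor algebras implies it on generators of
the second one. -/
lemma yd_gen_right
    (h : F ◁ X ◁ gen G ≫ gen F ▷ _ ≫ ydLeft (extPairing b) m₁ m₂ =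
      F ◁ X ◁ gen G ≫ gen F ▷ _ ≫ ydRight (extPairing b) m₁ m₂) :
    TensorAlg F ◁ X ◁ gen G ≫ ydLeft (extPairing b) m₁ m₂ =
      TensorAlg F ◁ X ◁ gen G ≫ ydRight (extPairing b) m₁ m₂ := by
  have hu : TensorAlg F ◁ X ◁ unit G ≫ ydLeft (extPairing b) m₁ m₂ =
      TensorAlg F ◁ X ◁ unit G ≫ ydRight (extPairing b) m₁ m₂ :=
    (one_ydLeft (extPairing b) m₁ m₂).trans (one_ydRight (extPairing b) m₁ m₂).symm
  have hL {K : D} (k : K ⟶ TensorAlg G) :=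
    restrict_ydBraiding_act (extPairing b) m₁ m₂ (𝟙 _) k
  have hR {K : D} (k : K ⟶ TensorAlg G) :=
    restrict_act_ydBraiding (extPairing b) m₁ m₂ (𝟙 _) k
  simp only [id_whiskerRight, id_comp] at hL hR
  -- Linearity on 1 ⊗ X, which holds unconditionally by `hu`, covers the part that leaves G ⊗ X.
  have hp {Z : D} (p : Z ⟶ 𝟙_ D ⊗ X) : TensorAlg F ◁ (p ≫ unit G ▷ X) ≫
      ((extPairing b).leftAction.tensor m₁).act ≫ ydBraiding m₂ =
      TensorAlg F ◁ (p ≫ unit G ▷ X) ≫ TensorAlg F ◁ ydBraiding m₂ ≫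
        (m₁.tensor (extPairing b).leftAction).act := by
    rw [MonoidalCategory.whiskerLeft_comp_assoc, MonoidalCategory.whiskerLeft_comp_assoc, hL, hR,
      unit_coextRight_congr hu]
  have key := leftLinear_of_gen ((extPairing b).leftAction.tensor m₁)
    (m₁.tensor (extPairing b).leftAction) (ydBraiding m₂) (gen G ▷ X) _ _
    (gen_tensor_act b m₁)
    (hp _)
    (by
      rw [restrict_ydBraiding_act, restrict_act_ydBraiding]
      congr 1
      -- The hypothesis `h` is the value at a generator; the value at the unit that primitivity also
      -- requires comes from `hu`.
      refine (gen_coextRight_congr ?_ h).symm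
      rw [whisker_exchange_assoc, whisker_exchange_assoc, hu])
  rw [hL, hR, cancel_epi] at key
  -- The counit of T(G) strips off the coextension.
  have := key =≫ (X ◁ ε[TensorAlg G] ≫ (ρ_ X).hom)
  rw [assoc, assoc, coextRight_counit, coextRight_counit] at this
  exact this.symm

/-- The Yetter-Drinfeld condition on generators of the second tensor algebra implies the
Yetter-Drinfeld condition. -/
lemma ydLeft_eq_ydRight
    (h : TensorAlg F ◁ X ◁ gen G ≫ ydLeft (extPairing b) m₁ m₂ =
      TensorAlg F ◁ X ◁ gen G ≫ ydRight (extPairing b) m₁ m₂) :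
    ydLeft (extPairing b) m₁ m₂ = ydRight (extPairing b) m₁ m₂ := by
  have hL := tensor_act_shearLeft (extPairing b) m₁ m₂
  have hR := shearLeft_tensor_act (extPairing b) m₁ m₂
  -- The roles are now exchanged: x ⊗ h ↦ h₁ ⊗ h₂ x is shown to be T(G)-linear. Its source is all of
  -- X ⊗ T(F), so the generator test is exactly `h`, with its first argument ranging over T(F).
  have key := rightLinear_of_gen (m₂.tensor (extPairing b).rightAction)
    ((extPairing b).rightAction.tensor m₂) ((β_ (TensorAlg F) X).inv ≫ shearLeft m₁) (by
      rw [← cancel_epi ((β_ (TensorAlg F) X).hom ▷ G), ← whisker_exchange_assoc,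
        ← whisker_exchange_assoc, hL, ← comp_whiskerRight_assoc, Iso.hom_inv_id_assoc, hR,
        coextLeft_natural, coextLeft_natural, h])
  rw [← cancel_epi ((β_ (TensorAlg F) X).hom ▷ TensorAlg G), hL, ← comp_whiskerRight_assoc,
    Iso.hom_inv_id_assoc, hR] at key
  have := key =≫ (ε[TensorAlg F] ▷ X ≫ (λ_ X).hom)
  rw [coextLeft_counit, coextLeft_counit, cancel_epi] at this
  exact this

/-- Primitivity of f and g gives four terms on each side. Those with ρ(1, g) or ρ(f, 1) vanish, and
ρ(1, 1) = 1 and ρ(f, g) = b(f, g) give the other two. -/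
lemma gen_gen_sides : F ◁ X ◁ gen G ≫ gen F ▷ _ ≫ ydLeft (extPairing b) m₁ m₂ =
      F ◁ (X ◁ gen G ≫ m₂.act) ≫ gen F ▷ X ≫ m₁.act +
      (α_ F X G).inv ≫ (β_ F X).hom ▷ G ≫ (α_ X F G).hom ≫ X ◁ b ≫ (ρ_ X).hom ∧
    F ◁ X ◁ gen G ≫ gen F ▷ _ ≫ ydRight (extPairing b) m₁ m₂ =
      F ◁ (β_ X G).hom ≫ (α_ F G X).inv ≫ b ▷ X ≫ (λ_ X).hom +
      (α_ F X G).inv ≫ (gen F ▷ X ≫ m₁.act) ▷ G ≫ X ◁ gen G ≫ m₂.act := by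
  have h1 : unit F ▷ X ≫ m₁.act = (λ_ X).hom := m₁.one_act
  have h2 : X ◁ unit G ≫ m₂.act = (ρ_ X).hom := m₂.act_one
  have e {Z : D} (f : (TensorAlg F ⊗ TensorAlg F) ⊗ (X ⊗ (TensorAlg G ⊗ TensorAlg G)) ⟶ Z) :
      F ◁ X ◁ gen G ≫ gen F ▷ _ ≫ (Δ[TensorAlg F] ⊗ₘ X ◁ Δ[TensorAlg G]) ≫ f =
      (gen F ≫ comul F ⊗ₘ X ◁ (gen G ≫ comul G)) ≫ f := by
    rw [← MonoidalCategory.tensorHom_def'_assoc, MonoidalCategory.whiskerLeft_comp,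
      ← tensorHom_comp_tensorHom_assoc]
    rfl
  have hz {U₁ U₂ V₁ V₂ : D} (a : U₁ ⊗ X ⟶ X) (c : X ⊗ V₁ ⟶ X) :
      sideLeft a c (0 : U₂ ⊗ V₂ ⟶ 𝟙_ D) = 0 := by simp [sideLeft]
  have hz' {U₁ U₂ V₁ V₂ : D} (a : U₂ ⊗ X ⟶ X) (c : X ⊗ V₂ ⟶ X) :
      sideRight (0 : U₁ ⊗ V₁ ⟶ 𝟙_ D) a c = 0 := by simp [sideRight]
  rw [ydLeft, ydRight, e, e, gen_comul, gen_comul]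
  simp only [MonoidalPreadditive.tensor_add, MonoidalPreadditive.add_tensor,
    MonoidalPreadditive.whiskerLeft_add, Preadditive.add_comp, MonoidalCategory.whiskerLeft_comp,
    ← tensorHom_comp_tensorHom, assoc, sideLeft_natural, sideRight_natural,
    unit_unit_extPairing, unit_gen_extPairing, gen_unit_extPairing, gen_gen_extPairing, h1, h2, hz,
    hz', comp_zero, add_zero, zero_add, sideLeft_unit_left, sideLeft_unit_right,
    sideRight_unit_left, sideRight_unit_right]
  constructor
  · rw [add_comm]
  · rw [add_comm]

end TensorAlg


/-! ### Comparison with the commutation condition -/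

section Commutation

variable {D : Type u} [Category.{v} D] [MonoidalCategory D] [Preadditive D]
  [MonoidalPreadditive D] [HasBinaryBiproducts D] [BraidedCategory D] [HasCoproductsOfShape ℕ D]
  [∀ Y : D, PreservesColimitsOfShape (Discrete ℕ) (tensorLeft Y)]
  [∀ Y : D, PreservesColimitsOfShape (Discrete ℕ) (tensorRight Y)]
  {F G X : D}

/-- The inverse braidings of X and G, in the restriction to G and in the half-braiding of ι⁻(G),
disappear after precomposition with the isomorphism F ⊗ (X ⊗ G) ⟶ (F ⊗ G) ⊗ X. Moving the negative
terms across then gives a subtraction-free identity. -/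
lemma satisfiesCommutation_iff (M : CatOver (centerSum (Center.ofBraidedObj F) (ofBraidedRevObj G)))
    (b : F ⊗ G ⟶ 𝟙_ D) (a : F ⊗ M.X ⟶ M.X) (c : M.X ⊗ G ⟶ M.X) (ha : M.restrictInl = a)
    (hc : M.restrictInr = (β_ M.X G).inv ≫ c) :
    M.SatisfiesCommutation b ↔
      F ◁ c ≫ a + (α_ F M.X G).inv ≫ (β_ F M.X).hom ▷ G ≫ (α_ M.X F G).hom ≫ M.X ◁ b ≫
          (ρ_ M.X).hom =
        F ◁ (β_ M.X G).hom ≫ (α_ F G M.X).inv ≫ b ▷ M.X ≫ (λ_ M.X).hom +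
          (α_ F M.X G).inv ≫ a ▷ G ≫ c := by
  have h1 : F ◁ (β_ M.X G).hom ≫ (α_ F G M.X).inv ≫ (α_ F G M.X).hom ≫
      F ◁ ((β_ M.X G).inv ≫ c) ≫ a = F ◁ c ≫ a := by simp
  have h2 : F ◁ (β_ M.X G).hom ≫ (α_ F G M.X).inv ≫ (β_ F G).hom ▷ M.X ≫ (α_ G F M.X).hom ≫
      G ◁ a ≫ (β_ M.X G).inv ≫ c = (α_ F M.X G).inv ≫ a ▷ G ≫ c := by
    -- By the hexagon the two crossings combine to the braiding of F ⊗ X with G, which cancels once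
    -- the action `a` has been slid through the inverse braiding.
    have e := braiding_tensor_left_hom F M.X G
    have e' : F ◁ (β_ M.X G).hom ≫ (α_ F G M.X).inv ≫ (β_ F G).hom ▷ M.X ≫ (α_ G F M.X).hom =
        (α_ F M.X G).inv ≫ (β_ (F ⊗ M.X) G).hom := by
      rw [e, Iso.inv_hom_id_assoc]
    rw [braiding_inv_naturality_right_assoc, reassoc_of% e', Iso.hom_inv_id_assoc]
  have h3 : F ◁ (β_ M.X G).hom ≫ (α_ F G M.X).inv ≫
      ((α_ F G M.X).hom ≫ F ◁ (β_ M.X G).inv ≫ (α_ F M.X G).inv ≫ (β_ F M.X).hom ▷ G ≫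
      (α_ M.X F G).hom) ≫ M.X ◁ b ≫ (ρ_ M.X).hom =
      (α_ F M.X G).inv ≫ (β_ F M.X).hom ▷ G ≫ (α_ M.X F G).hom ≫ M.X ◁ b ≫ (ρ_ M.X).hom := by
    simp
  have e : M.SatisfiesCommutation b ↔
      (α_ F G M.X).hom ≫ F ◁ ((β_ M.X G).inv ≫ c) ≫ a -
        (β_ F G).hom ▷ M.X ≫ (α_ G F M.X).hom ≫ G ◁ a ≫ (β_ M.X G).inv ≫ c =
      b ▷ M.X ≫ (λ_ M.X).hom - ((α_ F G M.X).hom ≫ F ◁ (β_ M.X G).inv ≫ (α_ F M.X G).inv ≫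
        (β_ F M.X).hom ▷ G ≫ (α_ M.X F G).hom) ≫ M.X ◁ b ≫ (ρ_ M.X).hom := by
    rw [← hc, ← ha]
    -- The half-braidings of ι⁺(F), ι⁻(G) and their tensor product in the centre unfold
    -- definitionally to the displayed braidings.
    exact Iff.rfl
  rw [e, ← cancel_epi (F ◁ (β_ M.X G).hom ≫ (α_ F G M.X).inv)]
  simp only [Preadditive.comp_sub, assoc] at h1 h2 h3 ⊢
  rw [h1, h2, h3, sub_eq_sub_iff_add_eq_add]

lemma inl_whisker_add {Z : D} (f : F ⊗ X ⟶ Z) (g : G ⊗ X ⟶ Z) :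
    (biprod.inl : F ⟶ F ⊞ G) ▷ X ≫ ((biprod.fst : F ⊞ G ⟶ F) ▷ X ≫ f +
      (biprod.snd : F ⊞ G ⟶ G) ▷ X ≫ g) = f := by
  rw [Preadditive.comp_add, whisker_inl_fst, whisker_inl_snd, add_zero]

lemma inr_whisker_add {Z : D} (f : F ⊗ X ⟶ Z) (g : G ⊗ X ⟶ Z) :
    (biprod.inr : G ⟶ F ⊞ G) ▷ X ≫ ((biprod.fst : F ⊞ G ⟶ F) ▷ X ≫ f +
      (biprod.snd : F ⊞ G ⟶ G) ▷ X ≫ g) = g := by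
  rw [Preadditive.comp_add, whisker_inr_fst, whisker_inr_snd, zero_add]

lemma restrictInl_inducedObj (mp : ModObj (TensorAlg F) X) (mm : RightAction (TensorAlg G) X) :
    (inducedObj mp mm).restrictInl = TensorAlg.gen F ▷ X ≫ mp.smul :=
  inl_whisker_add _ _

lemma restrictInr_inducedObj (mp : ModObj (TensorAlg F) X) (mm : RightAction (TensorAlg G) X) :
    (inducedObj mp mm).restrictInr = (β_ X G).inv ≫ X ◁ TensorAlg.gen G ≫ mm.act :=
  inr_whisker_add _ _

lemma isYetterDrinfeld_iff_gen (b : F ⊗ G ⟶ 𝟙_ D) (mp : ModObj (TensorAlg F) X)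
    (mm : RightAction (TensorAlg G) X) :
    IsYetterDrinfeld (TensorAlg.extPairing b) mp mm ↔
      F ◁ X ◁ TensorAlg.gen G ≫ TensorAlg.gen F ▷ _ ≫
          ydLeft (TensorAlg.extPairing b) (LeftAction.ofModObj mp) mm =
        F ◁ X ◁ TensorAlg.gen G ≫ TensorAlg.gen F ▷ _ ≫
          ydRight (TensorAlg.extPairing b) (LeftAction.ofModObj mp) mm := by
  rw [isYetterDrinfeld_iff]
  exact ⟨fun h => by rw [h], fun h => TensorAlg.ydLeft_eq_ydRight b _ _
    (TensorAlg.yd_gen_right b _ _ h)⟩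

end Commutation

end TensorHopf

end

theorem mainTheorem2 {D : Type u} [Category.{v} D] [Abelian D] [MonoidalCategory D]
    [MonoidalPreadditive D] [BraidedCategory D] [HasCoproductsOfShape ℕ D]
    [∀ Y : D, PreservesColimitsOfShape (Discrete ℕ) (tensorLeft Y)]
    [∀ Y : D, PreservesColimitsOfShape (Discrete ℕ) (tensorRight Y)]
    (Fp Fm : D) (b : Fp ⊗ Fm ⟶ 𝟙_ D) (X : D)
    (mp : ModObj (TensorHopf.TensorAlg Fp) X)
    (mm : TensorHopf.RightAction (TensorHopf.TensorAlg Fm) X) :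
    TensorHopf.IsYetterDrinfeld (TensorHopf.TensorAlg.extPairing b) mp mm ↔
      (TensorHopf.inducedObj mp mm).SatisfiesCommutation b := by
  obtain ⟨hL, hR⟩ := TensorHopf.TensorAlg.gen_gen_sides b (TensorHopf.LeftAction.ofModObj mp) mm
  rw [TensorHopf.isYetterDrinfeld_iff_gen, hL, hR]
  exact (TensorHopf.satisfiesCommutation_iff _ b _ _ (TensorHopf.restrictInl_inducedObj mp mm)
    (TensorHopf.restrictInr_inducedObj mp mm)).symm
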